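/- Let $M$ be a smooth $4$-manifold with a smooth coframe field $\{\vartheta^a\}_{a=0}^{3}$, declared orthonormal for $g=\eta_{ab}\,\vartheta^a\otimes\vartheta^b$, $\eta=\mathrm{diag}(1,-1,-1,-1)$; let $e_a$ be the dual frame, raise and lower indices with $\eta$, and sum over repeated indices. Let $*$ be the Hodge dual of $g$ with volume form $\vartheta^0\wedge\vartheta^1\wedge\vartheta^2\wedge\vartheta^3$ (so $\alpha\wedge *\beta=\langle\alpha,\beta\rangle\,\vartheta^0\wedge\vartheta^1\wedge\vartheta^2\wedge\vartheta^3$), $d^\dagger=-*d*$ and $\Box=d^\dagger d+d\,d^\dagger$. Define $C^a{}_{bc}$ and $B^a{}_{mnp}$ by $$d\vartheta^a=\tfrac12 C^a{}_{bc}\,\vartheta^b\wedge\vartheta^c,\quad C^a{}_{bc}=-C^a{}_{cb},\qquad dC^a{}_{mn}=B^a{}_{mnp}\,\vartheta^p,$$ and put $C_a=C^m{}_{am}$, ${}^{(1)}B_{ab}=B_{abm}{}^m$, ${}^{(2)}B_{ab}=B^m{}_{mab}$, ${}^{(3)}B_{ab}=B^m{}_{abm}$, $B={}^{(1)}B^a{}_a$,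 $${}^{(1)}A_{ab}=C_{abm}C^m,\quad {}^{(2)}A_{ab}=C_{mab}C^m,\quad {}^{(3)}A_{ab}=C_{amn}C_b{}^{mn},\quad {}^{(4)}A_{ab}=C_{amn}C^m{}_b{}^n,$$ $${}^{(5)}A_{ab}=C_{man}C^n{}_b{}^m,\quad {}^{(6)}A_{ab}=C_{man}C^m{}_b{}^n,\quad {}^{(7)}A_{ab}=C_aC_b,$$ ${}^{(1)}A={}^{(1)}A^a{}_a$, ${}^{(2)}A={}^{(3)}A^a{}_a$, ${}^{(3)}A={}^{(4)}A^a{}_a$. With $T_{(ab)}=\frac12(T_{ab}+T_{ba})$, $T_{[ab]}=\frac12(T_{ab}-T_{ba})$, the quasi-linear class consists of the equations $L_{ab}+Q_{ab}=0$ with real parameters $\beta_1,\dots,\beta_6,\alpha_1,\dots,\alpha_{12}$, where $$L_{ab}=\beta_1{}^{(1)}B_{(ab)}+\beta_2{}^{(2)}B_{(ab)}+\beta_3{}^{(3)}B_{ab}+\beta_4\eta_{ab}B+\beta_5{}^{(1)}B_{[ab]}+\beta_6{}^{(2)}B_{[ab]},$$ $$Q_{ab}=\alpha_1{}^{(1)}A_{(ab)}+\alpha_2{}^{(2)}A_{ab}+\alpha_3{}^{(3)}A_{ab}+\alpha_4{}^{(4)}A_{(ab)}+\alpha_5{}^{(5)}A_{ab}+\alpha_6{}^{(6)}A_{ab}+\alpha_7{}^{(7)}A_{ab}+\alpha_8{}^{(1)}A_{[ab]}+\alpha_9{}^{(4)}A_{[ab]}+\eta_{ab}\big(\alpha_{10}{}^{(1)}A+\alpha_{11}{}^{(2)}A+\alpha_{12}{}^{(3)}A\big).$$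 (i) The Hodge–de Rham Laplacian of the coframe is $$\Box\vartheta^a=-\Big({}^{(1)}B^a{}_b+{}^{(2)}B^a{}_b+C^a{}_{bn}C^n+\tfrac12\,C^a{}_{mn}C_b{}^{mn}\Big)\vartheta^b .$$ (ii) Write $\Box\vartheta^a=M^a{}_b\,\vartheta^b$. For the parameters $$\beta_1=\beta_2=\beta_5=\beta_6=1,\quad \beta_4=-\tfrac12,\quad \alpha_1=\alpha_8=1,\quad \alpha_3=\tfrac12,\quad \alpha_{10}=-\tfrac14,\quad \alpha_{11}=-\tfrac18$$ (all others zero) one has $L_{ab}+Q_{ab}=-\big(M_{ab}-\tfrac14\eta_{ab}M^p{}_p\big)$. Consequently, on every subset $U\subset M$, the equation $\Box\vartheta^a=\lambda\,\vartheta^a$ $(a=0,\dots,3)$ holds for some function $\lambda$ if and only if $L_{ab}+Q_{ab}=0$ on $U$ with these parameters. (iii) These parameters satisfy the harmonic conditions $$\beta_1=\beta_2,\qquad \beta_1=\alpha_1,\qquad \alpha_1-2\alpha_3-\alpha_4+3\alpha_5+2\alpha_6+\alpha_7=0,\qquad \beta_4=-2\alpha_3-\alpha_4-\alpha_6+\alpha_{10}-6\alpha_{11}-3\alpha_{12}.$$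 These conditions have the following meaning. Suppose that in some smooth local coordinates $(t,x^1,x^2,x^3)$ on an open set $V\subset M$ the coframe is quasi-conformal, $\vartheta^0=e^{-f}dt$, $\vartheta^i=e^{f}dx^i$ $(i=1,2,3)$, with $f=f(x^1,x^2,x^3)$. For all parameters satisfying the harmonic conditions, if $f$ is harmonic ($f_{11}+f_{22}+f_{33}=0$), then $L_{ab}+Q_{ab}=0$ on $V$; and if moreover $\beta_1,\beta_4$ are not both zero, $L_{ab}+Q_{ab}=0$ on $V$ implies that $f$ is harmonic. In particular, $\Box\vartheta^a=\lambda\vartheta^a$ holds on $V$ for some function $\lambda$ if and only if $f$ is harmonic. -/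

import Mathlib

open scoped Manifold ContDiff

noncomputable section

namespace Teleparallel

/-- The model space of a four-dimensional manifold. -/
abbrev E4 := EuclideanSpace ℝ (Fin 4)

/-- The three-dimensional Euclidean space of the spatial coordinates. -/
abbrev E3 := EuclideanSpace ℝ (Fin 3)

/-! ### The Minkowski matrix and the Levi-Civita symbol -/

/-- The diagonal entries of `η = diag(1, -1, -1, -1)`. As `η` is diagonal and `η⁻¹ = η`, an index
`a` is raised or lowered by multiplication with `sgn a`. -/
def sgn (a : Fin 4) : ℝ := if a = 0 then 1 else -1

/-- The Minkowski matrix `η_{ab}`. -/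
def eta (a b : Fin 4) : ℝ := if a = b then sgn a else 0

/-- The Levi-Civita symbol `ε_{c 0 c 1 c 2 c 3}`, normalised by `ε_{0123} = 1`. -/
def leviCivita (c : Fin 4 → Fin 4) : ℝ :=
  Matrix.det (Matrix.of fun i j : Fin 4 => if c i = j then (1 : ℝ) else 0)

/-! ### Differential forms on a manifold -/

section Forms

variable (M : Type*) [TopologicalSpace M] [ChartedSpace E4 M]

/-- Differential `p`-forms on `M` (smoothness is the separate predicate `IsSmoothForm`). -/
abbrev DForm (p : ℕ) := (x : M) → TangentSpace (𝓡 4) x [⋀^Fin p]→L[ℝ] ℝ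

variable {M}

/-- The coordinate representation of a form in the chart at `x₀`: its pullback under the inverse
chart. It is meaningful on the target of the chart. -/
def formInChart {p : ℕ} (x₀ : M) (w : DForm M p) (y : E4) : E4 [⋀^Fin p]→L[ℝ] ℝ :=
  (w ((extChartAt (𝓡 4) x₀).symm y)).compContinuousLinearMap
    (mfderiv 𝓘(ℝ, E4) (𝓡 4) (extChartAt (𝓡 4) x₀).symm y)

/-- A form is smooth if its coordinate representations are. -/
def IsSmoothForm {p : ℕ} (w : DForm M p) : Prop :=
  ∀ x₀ : M, ContDiffOn ℝ ∞ (formInChart x₀ w) (extChartAt (𝓡 4) x₀).target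

/-- The exterior derivative: at `x` it is computed in the chart at `x` and pulled back to `M`. -/
def dForm {p : ℕ} (w : DForm M p) : DForm M (p + 1) := fun x =>
  (extDeriv (formInChart x w) (extChartAt (𝓡 4) x x)).compContinuousLinearMap
    (mfderiv (𝓡 4) 𝓘(ℝ, E4) (extChartAt (𝓡 4) x) x)

/-- A field of covectors, as a `1`-form. -/
def oneForm (θ : (x : M) → TangentSpace (𝓡 4) x →L[ℝ] ℝ) : DForm M 1 := fun x =>
  ContinuousAlternatingMap.ofSubsingleton ℝ (TangentSpace (𝓡 4) x) ℝ (0 : Fin 1) (θ x)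

end Forms

/-! ### Coframes -/

/-- A smooth coframe field `ϑ⁰, ϑ¹, ϑ², ϑ³` on a four-dimensional manifold. It is declared to be
pseudo-orthonormal, that is, `M` carries the metric `g = η_{ab} ϑᵃ ⊗ ϑᵇ`. -/
structure Coframe (M : Type*) [TopologicalSpace M] [ChartedSpace E4 M] where
  /-- The `1`-forms of the coframe. -/
  form : Fin 4 → (x : M) → TangentSpace (𝓡 4) x →L[ℝ] ℝ
  smooth : ∀ a, IsSmoothForm (oneForm (form a))
  linearIndependent : ∀ x, LinearIndependent ℝ fun a => form a x

/-- The determinant of `q` row vectors of length `q`, as a continuous alternating map. -/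
def detForm (q : ℕ) : (Fin q → ℝ) [⋀^Fin q]→L[ℝ] ℝ :=
  { (Matrix.detRowAlternating : (Fin q → ℝ) [⋀^Fin q]→ₗ[ℝ] ℝ) with
    cont := by
      change Continuous fun A : Matrix (Fin q) (Fin q) ℝ => A.det
      exact continuous_id.matrix_det }

theorem bijective_pi_of_linearIndependent (θ : Fin 4 → E4 →L[ℝ] ℝ) (h : LinearIndependent ℝ θ) :
    Function.Bijective (ContinuousLinearMap.pi θ) := by
  have hd : Module.finrank ℝ E4 = Module.finrank ℝ (Fin 4 → ℝ) := by simp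
  have hsurj : Function.Surjective (ContinuousLinearMap.pi θ) := by
    by_contra hns
    have hr : LinearMap.range (ContinuousLinearMap.pi θ : E4 →ₗ[ℝ] (Fin 4 → ℝ)) ≠ ⊤ := fun h =>
      hns (LinearMap.range_eq_top.1 h)
    obtain ⟨f, hf, hker⟩ := Submodule.exists_le_ker_of_lt_top _ (lt_top_iff_ne_top.2 hr)
    rw [Fintype.linearIndependent_iff] at h
    have hz := h (fun a => f (Pi.single a 1)) (by
      ext1 v
      have h0 : f (ContinuousLinearMap.pi θ v) = 0 := hker ⟨v, rfl⟩
      rw [LinearMap.pi_apply_eq_sum_univ f] at h0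
      have hs : ∀ a : Fin 4, (Pi.single a 1 : Fin 4 → ℝ) = fun j => if a = j then 1 else 0 := by
        intro a
        ext j
        simp [Pi.single_apply, eq_comm]
      simpa [mul_comm, hs] using h0)
    apply hf
    ext a
    simpa using hz a
  exact ⟨(LinearMap.injective_iff_surjective_of_finrank_eq_finrank
    (f := (ContinuousLinearMap.pi θ : E4 →ₗ[ℝ] (Fin 4 → ℝ))) hd).2 hsurj, hsurj⟩

namespace Coframe

variable {M : Type*} [TopologicalSpace M] [ChartedSpace E4 M] (ϑ : Coframe M)

/-- The components `v ↦ (ϑᵃ(v))ₐ` of a tangent vector. -/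
def components (x : M) : TangentSpace (𝓡 4) x →L[ℝ] (Fin 4 → ℝ) :=
  ContinuousLinearMap.pi fun a => ϑ.form a x

theorem components_bijective (x : M) : Function.Bijective (ϑ.components x) :=
  bijective_pi_of_linearIndependent (ϑ.form · x) (ϑ.linearIndependent x)

/-- The frame `e_a` dual to the coframe: `ϑᵇ(e_a) = δᵇₐ`. -/
def frame (a : Fin 4) (x : M) : TangentSpace (𝓡 4) x :=
  (Equiv.ofBijective _ (ϑ.components_bijective x)).symm (Pi.single a 1)

theorem form_frame (a b : Fin 4) (x : M) : ϑ.form b x (ϑ.frame a x) = if b = a then 1 else 0 :=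
  (congrFun ((Equiv.ofBijective _ (ϑ.components_bijective x)).apply_symm_apply
    (Pi.single a (1 : ℝ))) b).trans (Pi.single_apply a (1 : ℝ) b)

/-- The product `ϑ^{b 0} ∧ ... ∧ ϑ^{b (q-1)}`, with value `det (ϑ^{b i}(v j))` on `v`. -/
def wedge {q : ℕ} (b : Fin q → Fin 4) : DForm M q := fun x =>
  (detForm q).compContinuousLinearMap (ContinuousLinearMap.pi fun i => ϑ.form (b i) x)

/-- The Hodge dual of `p`-forms with respect to `g = η_{ab} ϑᵃ ⊗ ϑᵇ` and the volume form
`ϑ⁰ ∧ ϑ¹ ∧ ϑ² ∧ ϑ³`: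
`*α = 1/(p! q!) ∑ α^{a₁...a_p} ε_{a₁...a_p b₁...b_q} ϑ^{b₁} ∧ ... ∧ ϑ^{b_q}`, `q = 4 - p`,
so that `α ∧ *β = ⟨α, β⟩ ϑ⁰ ∧ ϑ¹ ∧ ϑ² ∧ ϑ³`. -/
def hodge {p q : ℕ} (h : 4 = p + q) (α : DForm M p) : DForm M q := fun x =>
  ((p.factorial : ℝ) * (q.factorial : ℝ))⁻¹ •
    ∑ a : Fin p → Fin 4, ∑ b : Fin q → Fin 4,
      ((∏ i, sgn (a i)) * α x (fun i => ϑ.frame (a i) x) *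
        leviCivita (fun i => Fin.append a b (Fin.cast h i))) • ϑ.wedge b x

/-- The coderivative `d† = - * d *` from `(p+1)`-forms to `p`-forms (`q = 3 - p`). -/
def codiff {p q : ℕ} (h : 4 = p + 1 + q) (α : DForm M (p + 1)) : DForm M p := fun x =>
  -(ϑ.hodge (p := q + 1) (q := p) (by omega) (dForm (ϑ.hodge h α)) x)

/-- The Hodge-de Rham Laplacian `□ = d† d + d d†` on `1`-forms. -/
def box (α : DForm M 1) : DForm M 1 := fun x =>
  ϑ.codiff (p := 1) (q := 2) (by norm_num) (dForm α) x +
    dForm (ϑ.codiff (p := 0) (q := 3) (by norm_num) α) x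

/-- `□ϑᵃ`. -/
def boxForm (a : Fin 4) : DForm M 1 := ϑ.box (oneForm (ϑ.form a))

/-- The matrix `Mᵃ_b` of `□ϑᵃ = Mᵃ_b ϑᵇ`. -/
def boxMatrix (x : M) (a b : Fin 4) : ℝ := ϑ.boxForm a x fun _ => ϑ.frame b x

/-! ### Objects of anholonomity and `B`-objects -/

/-- `Cᵃ_{bc} = e_c ⌟ (e_b ⌟ dϑᵃ)`, so that `dϑᵃ = ½ Cᵃ_{bc} ϑᵇ ∧ ϑᶜ`. -/
def C (a b c : Fin 4) (x : M) : ℝ := dForm (oneForm (ϑ.form a)) x ![ϑ.frame b x, ϑ.frame c x]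

/-- `C_{abc}`. -/
def Clow (a b c : Fin 4) (x : M) : ℝ := sgn a * ϑ.C a b c x

/-- `C_a = Cᵐ_{am}`. -/
def Ctr (a : Fin 4) (x : M) : ℝ := ∑ m, ϑ.C m a m x

/-- `Bᵃ_{mnp}`, defined by `dCᵃ_{mn} = Bᵃ_{mnp} ϑᵖ`. -/
def B (a m n p : Fin 4) (x : M) : ℝ := mvfderiv (𝓡 4) (ϑ.C a m n) x (ϑ.frame p x)

/-- `⁽¹⁾B_{ab} = B_{abm}{}^m`. -/
def B1 (x : M) (a b : Fin 4) : ℝ := ∑ m, sgn m * (sgn a * ϑ.B a b m m x)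

/-- `⁽²⁾B_{ab} = Bᵐ_{mab}`. -/
def B2 (x : M) (a b : Fin 4) : ℝ := ∑ m, ϑ.B m m a b x

/-- `⁽³⁾B_{ab} = Bᵐ_{abm}`. -/
def B3 (x : M) (a b : Fin 4) : ℝ := ∑ m, ϑ.B m a b m x

/-! ### Quadratic invariants -/

/-- `⁽¹⁾A_{ab} = C_{abm} Cᵐ`. -/
def A1 (x : M) (a b : Fin 4) : ℝ := ∑ m, ϑ.Clow a b m x * (sgn m * ϑ.Ctr m x)

/-- `⁽²⁾A_{ab} = C_{mab} Cᵐ`. -/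
def A2 (x : M) (a b : Fin 4) : ℝ := ∑ m, ϑ.Clow m a b x * (sgn m * ϑ.Ctr m x)

/-- `⁽³⁾A_{ab} = C_{amn} C_b{}^{mn}`. -/
def A3 (x : M) (a b : Fin 4) : ℝ :=
  ∑ m, ∑ n, ϑ.Clow a m n x * (sgn m * sgn n * ϑ.Clow b m n x)

/-- `⁽⁴⁾A_{ab} = C_{amn} Cᵐ_b{}ⁿ`. -/
def A4 (x : M) (a b : Fin 4) : ℝ := ∑ m, ∑ n, ϑ.Clow a m n x * (sgn n * ϑ.C m b n x)

/-- `⁽⁵⁾A_{ab} = C_{man} Cⁿ_b{}ᵐ`. -/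
def A5 (x : M) (a b : Fin 4) : ℝ := ∑ m, ∑ n, ϑ.Clow m a n x * (sgn m * ϑ.C n b m x)

/-- `⁽⁶⁾A_{ab} = C_{man} Cᵐ_b{}ⁿ`. -/
def A6 (x : M) (a b : Fin 4) : ℝ := ∑ m, ∑ n, ϑ.Clow m a n x * (sgn n * ϑ.C m b n x)

/-- `⁽⁷⁾A_{ab} = C_a C_b`. -/
def A7 (x : M) (a b : Fin 4) : ℝ := ϑ.Ctr a x * ϑ.Ctr b x

end Coframe

/-- `T_{(ab)} = ½ (T_{ab} + T_{ba})`. -/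
def symPart (T : Fin 4 → Fin 4 → ℝ) (a b : Fin 4) : ℝ := (T a b + T b a) / 2

/-- `T_{[ab]} = ½ (T_{ab} - T_{ba})`. -/
def antiPart (T : Fin 4 → Fin 4 → ℝ) (a b : Fin 4) : ℝ := (T a b - T b a) / 2

/-- The trace `T_a{}ᵃ`. -/
def tr (T : Fin 4 → Fin 4 → ℝ) : ℝ := ∑ a, sgn a * T a a

/-! ### The quasi-linear class of field equations -/

/-- The free parameters `β₁, ..., β₆` and `α₁, ..., α₁₂`. -/
structure Params where
  β₁ : ℝ
  β₂ : ℝ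
  β₃ : ℝ
  β₄ : ℝ
  β₅ : ℝ
  β₆ : ℝ
  α₁ : ℝ
  α₂ : ℝ
  α₃ : ℝ
  α₄ : ℝ
  α₅ : ℝ
  α₆ : ℝ
  α₇ : ℝ
  α₈ : ℝ
  α₉ : ℝ
  α₁₀ : ℝ
  α₁₁ : ℝ
  α₁₂ : ℝ

namespace Coframe

variable {M : Type*} [TopologicalSpace M] [ChartedSpace E4 M] (ϑ : Coframe M)

/-- The leading part `L_{ab}`; the scalar `B` is the trace of `⁽¹⁾B`. -/
def leading (p : Params) (x : M) (a b : Fin 4) : ℝ :=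
  p.β₁ * symPart (ϑ.B1 x) a b + p.β₂ * symPart (ϑ.B2 x) a b + p.β₃ * ϑ.B3 x a b +
    p.β₄ * (eta a b * tr (ϑ.B1 x)) + p.β₅ * antiPart (ϑ.B1 x) a b +
    p.β₆ * antiPart (ϑ.B2 x) a b

/-- The quadratic part `Q_{ab}`; the scalars `⁽¹⁾A`, `⁽²⁾A`, `⁽³⁾A` are the traces of the matrices
`⁽¹⁾A_{ab}`, `⁽³⁾A_{ab}`, `⁽⁴⁾A_{ab}`. -/
def quadratic (p : Params) (x : M) (a b : Fin 4) : ℝ :=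
  p.α₁ * symPart (ϑ.A1 x) a b + p.α₂ * ϑ.A2 x a b + p.α₃ * ϑ.A3 x a b +
    p.α₄ * symPart (ϑ.A4 x) a b + p.α₅ * ϑ.A5 x a b + p.α₆ * ϑ.A6 x a b +
    p.α₇ * ϑ.A7 x a b + p.α₈ * antiPart (ϑ.A1 x) a b + p.α₉ * antiPart (ϑ.A4 x) a b +
    eta a b * (p.α₁₀ * tr (ϑ.A1 x) + p.α₁₁ * tr (ϑ.A3 x) + p.α₁₂ * tr (ϑ.A4 x))

/-- The field equation `L_{ab} + Q_{ab} = 0` at the point `x`. -/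
def FieldEq (p : Params) (x : M) : Prop :=
  ∀ a b, ϑ.leading p x a b + ϑ.quadratic p x a b = 0

/-- The equation `□ϑᵃ = λ ϑᵃ`, `a = 0, 1, 2, 3`, on the set `U`, for some function `λ`. -/
def WaveEqOn (U : Set M) : Prop :=
  ∃ lam : M → ℝ, ∀ x ∈ U, ∀ a, ϑ.boxForm a x = lam x • oneForm (ϑ.form a) x

/-- In the local coordinates `φ = (t, x¹, x², x³)` the coframe is quasi-conformal with the function
`f = f(x¹, x², x³)`: `ϑ⁰ = e^{-f} dt` and `ϑⁱ = e^f dxⁱ`, `i = 1, 2, 3`. -/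
def IsQuasiConformal (φ : OpenPartialHomeomorph M E4) (f : E3 → ℝ) : Prop :=
  ∀ x ∈ φ.source,
    ϑ.form 0 x = Real.exp (-f !₂[φ x 1, φ x 2, φ x 3]) • mvfderiv (𝓡 4) (fun y => φ y 0) x ∧
    ∀ i : Fin 3, ϑ.form i.succ x =
      Real.exp (f !₂[φ x 1, φ x 2, φ x 3]) • mvfderiv (𝓡 4) (fun y => φ y i.succ) x

end Coframe

/-- The domain of the spatial coordinates of `φ`. -/
def spatialDomain {M : Type*} [TopologicalSpace M] (φ : OpenPartialHomeomorph M E4) : Set E3 :=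
  (fun y : E4 => !₂[y 1, y 2, y 3]) '' φ.target

/-- The parameters of the traceless wave-type equation. -/
def waveParams : Params where
  β₁ := 1
  β₂ := 1
  β₃ := 0
  β₄ := -1 / 2
  β₅ := 1
  β₆ := 1
  α₁ := 1
  α₂ := 0
  α₃ := 1 / 2
  α₄ := 0
  α₅ := 0
  α₆ := 0
  α₇ := 0
  α₈ := 1
  α₉ := 0
  α₁₀ := -1 / 4
  α₁₁ := -1 / 8
  α₁₂ := 0

/-- The harmonic conditions on the parameters. -/
def Params.HarmonicConditions (p : Params) : Prop :=
  p.β₁ = p.β₂ ∧ p.β₁ = p.α₁ ∧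
    p.α₁ - 2 * p.α₃ - p.α₄ + 3 * p.α₅ + 2 * p.α₆ + p.α₇ = 0 ∧
    p.β₄ = -2 * p.α₃ - p.α₄ - p.α₆ + p.α₁₀ - 6 * p.α₁₁ - 3 * p.α₁₂

end Teleparallel

end

open Teleparallel

/-! The Laplacian is computed in the moving frame. `dForm` at a point uses the preferred chart
there, and that chart changes with the point, so quantities such as `C` can be differentiated only
once d is known to be computable in one fixed chart (`dForm_eq_of_mem_maximalAtlas`, naturality of
the exterior derivative under transition maps). In such a chart the frame is the inverse matrix of
the coframe, hence smooth, and differentiating ϑᵏ(e_i) = δ gives [e_b, e_c] = -Cᵏ_{bc} e_k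
(`lieBracket_vec`). The invariant formula for d then expresses frame components of dw through frame
derivatives of components of w and terms C·w (`dForm_frame_eq`).

The Hodge dual acts on frame components by contraction with ε (`hodge_frame`). Since *dϑᵃ has
components ±C, d†dϑᵃ consists of B terms and C·C terms (`coeff_codiff_dForm`). Since *ϑᵃ has
constant components, d†ϑᵃ is the function Cᵃ, and its differential gives ⁽²⁾B
(`coeff_dForm_codiff`). The sum is (i). For (ii), the chosen parameters form minus the traceless
part of M, and M is a multiple of the identity exactly when that part vanishes.

For (iii), put P_b = e^{-f}∂_b f, K_{bc} = e^{-2f}∂_b∂_c f, T = tr K over space and N = -|P|². Then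
C is linear in P, and the frame derivative of P_b along e_d is K_{bd} - P_b P_d. Every invariant
becomes a combination of K_{ab}, P_a P_b, δ_{ab}N, η_{ab}N, δ_{ab}T and η_{ab}T
(`fieldEq_lhs_of_C_eq`). The four harmonic conditions are the vanishing of the coefficients of
K_{ab}, δ_{ab}N, P_a P_b and η_{ab}N, in this order. What remains is (β₄η_{ab} - β₁δ_{ab})T with T =
e^{-2f}Δf, which gives both implications. -/

noncomputable section
namespace Teleparallel

open Set Filter Topology

/-! ### Change of charts and the exterior derivative -/

section Charts

theorem eventually_symm_mem_source {X : Type*} [TopologicalSpace X]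
    {φ φ' : OpenPartialHomeomorph X E4} {y : E4} (hy : y ∈ φ.target) (hy' : φ.symm y ∈ φ'.source) :
    ∀ᶠ z in 𝓝 y, z ∈ φ.target ∧ φ.symm z ∈ φ'.source :=
  (Filter.Eventually.and (p := fun z => z ∈ φ.target) (φ.open_target.mem_nhds hy)
    ((φ.continuousAt_symm hy).eventually (φ'.open_source.mem_nhds hy')))

variable {M : Type*} [TopologicalSpace M] [ChartedSpace E4 M]

/-- The coordinate representation of a form in an arbitrary chart. -/
def pullChart (φ : OpenPartialHomeomorph M E4) {p : ℕ} (w : DForm M p) (y : E4) :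
    E4 [⋀^Fin p]→L[ℝ] ℝ :=
  (w (φ.symm y)).compContinuousLinearMap (mfderiv 𝓘(ℝ, E4) (𝓡 4) φ.symm y)

theorem formInChart_eq_pullChart {p : ℕ} (x : M) (w : DForm M p) :
    formInChart x w = pullChart (chartAt E4 x) w := rfl

theorem target_extChartAt_eq (x : M) :
    (extChartAt (𝓡 4) x).target = (chartAt E4 x).target := by
  simp [mfld_simps]

variable {φ φ' : OpenPartialHomeomorph M E4}

theorem mdifferentiable_of_mem_maximalAtlas (hφ : φ ∈ IsManifold.maximalAtlas (𝓡 4) ∞ M) :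
    φ.MDifferentiable (𝓡 4) 𝓘(ℝ, E4) :=
  ⟨(contMDiffOn_of_mem_maximalAtlas hφ).mdifferentiableOn (by simp),
    (contMDiffOn_symm_of_mem_maximalAtlas hφ).mdifferentiableOn (by simp)⟩

/-- The transition between two charts is smooth. -/
theorem contDiffAt_transition (hφ : φ ∈ IsManifold.maximalAtlas (𝓡 4) ∞ M)
    (hφ' : φ' ∈ IsManifold.maximalAtlas (𝓡 4) ∞ M) {y : E4} (hy : y ∈ φ.target)
    (hy' : φ.symm y ∈ φ'.source) : ContDiffAt ℝ ∞ (φ' ∘ φ.symm) y := by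
  rw [← contMDiffAt_iff_contDiffAt]
  exact (contMDiffAt_of_mem_maximalAtlas hφ' hy').comp y
    (contMDiffAt_symm_of_mem_maximalAtlas hφ hy)

theorem mfderiv_symm_eq_comp (hφ : φ ∈ IsManifold.maximalAtlas (𝓡 4) ∞ M)
    (hφ' : φ' ∈ IsManifold.maximalAtlas (𝓡 4) ∞ M) {y : E4} (hy : y ∈ φ.target)
    (hy' : φ.symm y ∈ φ'.source) :
    (mfderiv 𝓘(ℝ, E4) (𝓡 4) φ.symm y : E4 →L[ℝ] E4) =
      ContinuousLinearMap.comp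
        (mfderiv 𝓘(ℝ, E4) (𝓡 4) φ'.symm (φ' (φ.symm y)) : E4 →L[ℝ] E4)
        (fderiv ℝ (φ' ∘ φ.symm) y) := by
  have h1 : (φ.symm : E4 → M) =ᶠ[𝓝 y] φ'.symm ∘ (φ' ∘ φ.symm) := by
    filter_upwards [eventually_symm_mem_source hy hy'] with z hz
    simp [φ'.left_inv hz.2]
  have h2 : mfderiv 𝓘(ℝ, E4) (𝓡 4) φ.symm y =
      mfderiv 𝓘(ℝ, E4) (𝓡 4) (φ'.symm ∘ (φ' ∘ φ.symm)) y := h1.mfderiv_eq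
  have h3 := mfderiv_comp (I := 𝓘(ℝ, E4)) (I' := 𝓘(ℝ, E4)) (I'' := 𝓡 4) y
    (g := φ'.symm) (f := φ' ∘ φ.symm)
    ((mdifferentiable_of_mem_maximalAtlas hφ').mdifferentiableAt_symm (φ'.map_source hy'))
    ((contDiffAt_transition hφ hφ' hy hy').contMDiffAt.mdifferentiableAt (by simp))
  rw [mfderiv_eq_fderiv] at h3
  exact h2.trans h3

theorem mfderiv_eq_comp (hφ : φ ∈ IsManifold.maximalAtlas (𝓡 4) ∞ M)
    (hφ' : φ' ∈ IsManifold.maximalAtlas (𝓡 4) ∞ M) {x : M} (hx : x ∈ φ.source)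
    (hx' : x ∈ φ'.source) :
    (mfderiv (𝓡 4) 𝓘(ℝ, E4) φ' x : E4 →L[ℝ] E4) =
      ContinuousLinearMap.comp (fderiv ℝ (φ' ∘ φ.symm) (φ x))
        (mfderiv (𝓡 4) 𝓘(ℝ, E4) φ x : E4 →L[ℝ] E4) := by
  have hy := φ.map_source hx
  have hy' : φ.symm (φ x) ∈ φ'.source := by rwa [φ.left_inv hx]
  have h1 : (φ' : M → E4) =ᶠ[𝓝 x] (φ' ∘ φ.symm) ∘ φ := by
    filter_upwards [φ.open_source.mem_nhds hx] with z hz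
    simp [φ.left_inv hz]
  have h2 : mfderiv (𝓡 4) 𝓘(ℝ, E4) φ' x =
      mfderiv (𝓡 4) 𝓘(ℝ, E4) ((φ' ∘ φ.symm) ∘ φ) x := h1.mfderiv_eq
  have h3 := mfderiv_comp (I := 𝓡 4) (I' := 𝓘(ℝ, E4)) (I'' := 𝓘(ℝ, E4)) x
    (g := φ' ∘ φ.symm) (f := φ)
    ((contDiffAt_transition hφ hφ' hy hy').contMDiffAt.mdifferentiableAt (by simp))
    ((mdifferentiable_of_mem_maximalAtlas hφ).mdifferentiableAt hx)
  rw [mfderiv_eq_fderiv] at h3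
  exact h2.trans h3

/-- The chain rule for φ⁻¹ = φ'⁻¹ ∘ (φ' ∘ φ⁻¹). The auxiliary `key` moves the base point of `w`, on
which the type of its value depends. -/
theorem pullChart_transition {p : ℕ} (w : DForm M p)
    (hφ : φ ∈ IsManifold.maximalAtlas (𝓡 4) ∞ M)
    (hφ' : φ' ∈ IsManifold.maximalAtlas (𝓡 4) ∞ M) {y : E4} (hy : y ∈ φ.target)
    (hy' : φ.symm y ∈ φ'.source) :
    pullChart φ w y = (pullChart φ' w ((φ' ∘ φ.symm) y)).compContinuousLinearMap
      (fderiv ℝ (φ' ∘ φ.symm) y) := by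
  ext v
  have h := mfderiv_symm_eq_comp hφ hφ' hy hy'
  have hp : φ'.symm (φ' (φ.symm y)) = φ.symm y := φ'.left_inv hy'
  have key : ∀ (z : M) (_ : z = φ.symm y) (u : Fin p → E4),
      (w z : E4 [⋀^Fin p]→L[ℝ] ℝ) u = (w (φ.symm y) : E4 [⋀^Fin p]→L[ℝ] ℝ) u := by
    rintro z rfl u; rfl
  refine Eq.trans ?_ (key _ hp _).symm
  change (w (φ.symm y) : E4 [⋀^Fin p]→L[ℝ] ℝ)
    (fun i => (mfderiv 𝓘(ℝ, E4) (𝓡 4) φ.symm y : E4 →L[ℝ] E4) (v i)) = _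
  rw [h]
  rfl

variable [IsManifold (𝓡 4) ∞ M]

/-- The exterior derivative may be computed in any chart. -/
theorem dForm_eq_of_mem_maximalAtlas {p : ℕ} (w : DForm M p)
    (hφ : φ ∈ IsManifold.maximalAtlas (𝓡 4) ∞ M) {x : M} (hx : x ∈ φ.source)
    (hw : DifferentiableAt ℝ (pullChart φ w) (φ x)) :
    dForm w x = (extDeriv (pullChart φ w) (φ x)).compContinuousLinearMap
      (mfderiv (𝓡 4) 𝓘(ℝ, E4) φ x : E4 →L[ℝ] E4) := by
  set ψ := chartAt E4 x with hψdef
  have hψ : ψ ∈ IsManifold.maximalAtlas (𝓡 4) ∞ M := IsManifold.chart_mem_maximalAtlas x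
  have hxψ : x ∈ ψ.source := mem_chart_source E4 x
  have hy := ψ.map_source hxψ
  have hy' : ψ.symm (ψ x) ∈ φ.source := by rwa [ψ.left_inv hxψ]
  -- The two representations must agree as germs, not only at the point, because `extDeriv`
  -- differentiates them.
  have h1 : pullChart ψ w =ᶠ[𝓝 (ψ x)] fun y =>
      (pullChart φ w ((φ ∘ ψ.symm) y)).compContinuousLinearMap (fderiv ℝ (φ ∘ ψ.symm) y) := by
    filter_upwards [eventually_symm_mem_source hy hy'] with z hz
    exact pullChart_transition w hψ hφ hz.1 hz.2
  have hτ : (φ ∘ ψ.symm) (ψ x) = φ x := by simp [ψ.left_inv hxψ]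
  have hw' : DifferentiableAt ℝ (pullChart φ w) ((φ ∘ ψ.symm) (ψ x)) := by rw [hτ]; exact hw
  have h2 := extDeriv_pullback hw' (contDiffAt_transition hψ hφ hy hy')
    (by rw [minSmoothness_of_isRCLikeNormedField]; exact WithTop.coe_le_coe.2 le_top)
  have h3 := mfderiv_eq_comp hψ hφ hxψ hx
  have h4 : dForm w x = (extDeriv (pullChart ψ w) (ψ x)).compContinuousLinearMap
      (mfderiv (𝓡 4) 𝓘(ℝ, E4) ψ x : E4 →L[ℝ] E4) := rfl
  rw [h4, h1.extDeriv_eq, h2, hτ, h3]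
  rfl

end Charts

/-- Covectors as `1`-forms. -/
def covectorEquiv : (E4 →L[ℝ] ℝ) ≃ₗᵢ[ℝ] (E4 [⋀^Fin 1]→L[ℝ] ℝ) :=
  ContinuousAlternatingMap.ofSubsingletonLIE (𝕜 := ℝ) (ι := Fin 1) (E := E4) (F := ℝ) (0 : Fin 1)

/-! ### Coframe, dual frame and structure functions in a chart -/

namespace Coframe

variable {M : Type*} [TopologicalSpace M] [ChartedSpace E4 M] (ϑ : Coframe M)

/-- The coframe covector `ϑᵃ` in a chart. -/
def cov (φ : OpenPartialHomeomorph M E4) (a : Fin 4) (y : E4) : E4 →L[ℝ] ℝ :=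
  ContinuousLinearMap.comp (ϑ.form a (φ.symm y) : E4 →L[ℝ] ℝ)
    (mfderiv 𝓘(ℝ, E4) (𝓡 4) φ.symm y : E4 →L[ℝ] E4)

/-- The frame vector `e_b` in a chart. -/
def vec (φ : OpenPartialHomeomorph M E4) (b : Fin 4) (y : E4) : E4 :=
  (mfderiv (𝓡 4) 𝓘(ℝ, E4) φ (φ.symm y) : E4 →L[ℝ] E4) (ϑ.frame b (φ.symm y))

theorem pullChart_oneForm (φ : OpenPartialHomeomorph M E4) (a : Fin 4) :
    pullChart φ (oneForm (ϑ.form a)) = fun y =>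
      covectorEquiv (ϑ.cov φ a y) := rfl

variable {φ : OpenPartialHomeomorph M E4}

theorem mfderiv_symm_vec (hφ : φ ∈ IsManifold.maximalAtlas (𝓡 4) ∞ M) {y : E4}
    (hy : y ∈ φ.target) (b : Fin 4) :
    (mfderiv 𝓘(ℝ, E4) (𝓡 4) φ.symm y : E4 →L[ℝ] E4) (ϑ.vec φ b y) = ϑ.frame b (φ.symm y) := by
  have h := (mdifferentiable_of_mem_maximalAtlas hφ).symm_comp_deriv (φ.map_target hy)
  rw [φ.right_inv hy] at h
  exact congrArg (fun T : E4 →L[ℝ] E4 => T (ϑ.frame b (φ.symm y))) h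

theorem cov_vec (hφ : φ ∈ IsManifold.maximalAtlas (𝓡 4) ∞ M) {y : E4}
    (hy : y ∈ φ.target) (a b : Fin 4) : ϑ.cov φ a y (ϑ.vec φ b y) = if a = b then 1 else 0 := by
  refine Eq.trans ?_ (ϑ.form_frame b a (φ.symm y))
  exact congrArg (ϑ.form a (φ.symm y) : E4 →L[ℝ] ℝ) (ϑ.mfderiv_symm_vec hφ hy b)

theorem pullChart_vec {p : ℕ} (w : DForm M p) (hφ : φ ∈ IsManifold.maximalAtlas (𝓡 4) ∞ M)
    {y : E4} (hy : y ∈ φ.target) (c : Fin p → Fin 4) :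
    pullChart φ w y (fun i => ϑ.vec φ (c i) y) =
      w (φ.symm y) fun i => ϑ.frame (c i) (φ.symm y) := by
  refine congrArg (w (φ.symm y) : E4 [⋀^Fin p]→L[ℝ] ℝ) ?_
  funext i
  exact ϑ.mfderiv_symm_vec hφ hy (c i)

theorem bijective_cov (hφ : φ ∈ IsManifold.maximalAtlas (𝓡 4) ∞ M) {y : E4}
    (hy : y ∈ φ.target) :
    Function.Bijective (ContinuousLinearMap.pi fun a => ϑ.cov φ a y) :=
  (ϑ.components_bijective (φ.symm y)).comp
    ((mdifferentiable_of_mem_maximalAtlas hφ).symm.mfderiv_bijective hy)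

/-- The coframe in a chart as an isomorphism. -/
def covEquiv (hφ : φ ∈ IsManifold.maximalAtlas (𝓡 4) ∞ M) {y : E4} (hy : y ∈ φ.target) :
    E4 ≃L[ℝ] (Fin 4 → ℝ) :=
  (LinearEquiv.ofBijective (ContinuousLinearMap.pi fun a => ϑ.cov φ a y :
    E4 →ₗ[ℝ] (Fin 4 → ℝ)) (ϑ.bijective_cov hφ hy)).toContinuousLinearEquiv

theorem coe_covEquiv (hφ : φ ∈ IsManifold.maximalAtlas (𝓡 4) ∞ M) {y : E4} (hy : y ∈ φ.target) :
    (ϑ.covEquiv hφ hy : E4 →L[ℝ] (Fin 4 → ℝ)) = ContinuousLinearMap.pi fun a => ϑ.cov φ a y := by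
  ext v a
  rfl

theorem vec_eq_inverse (hφ : φ ∈ IsManifold.maximalAtlas (𝓡 4) ∞ M) {y : E4}
    (hy : y ∈ φ.target) (b : Fin 4) :
    ϑ.vec φ b y = (ContinuousLinearMap.pi fun a => ϑ.cov φ a y).inverse (Pi.single b 1) := by
  rw [← ϑ.coe_covEquiv hφ hy, ContinuousLinearMap.inverse_equiv]
  change _ = (ϑ.covEquiv hφ hy).symm _
  rw [ContinuousLinearEquiv.eq_symm_apply]
  ext a
  refine (ϑ.cov_vec hφ hy a b).trans ?_
  simp [Pi.single_apply]

theorem eq_sum_cov_smul_vec (hφ : φ ∈ IsManifold.maximalAtlas (𝓡 4) ∞ M) {y : E4}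
    (hy : y ∈ φ.target) (v : E4) : v = ∑ k, ϑ.cov φ k y v • ϑ.vec φ k y := by
  apply (ϑ.bijective_cov hφ hy).1
  ext a
  simp [ϑ.cov_vec hφ hy]

theorem cov_transition (hφ : φ ∈ IsManifold.maximalAtlas (𝓡 4) ∞ M)
    {φ' : OpenPartialHomeomorph M E4}
    (hφ' : φ' ∈ IsManifold.maximalAtlas (𝓡 4) ∞ M) {y : E4} (hy : y ∈ φ.target)
    (hy' : φ.symm y ∈ φ'.source) (a : Fin 4) :
    ϑ.cov φ a y = (ϑ.cov φ' a ((φ' ∘ φ.symm) y)).comp (fderiv ℝ (φ' ∘ φ.symm) y) := by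
  ext v
  exact congrArg (fun f : E4 [⋀^Fin 1]→L[ℝ] ℝ => f fun _ => v)
    (pullChart_transition (oneForm (ϑ.form a)) hφ hφ' hy hy')

/-- The derivative of a function along the frame, computed in a chart. -/
theorem mvfderiv_frame (hφ : φ ∈ IsManifold.maximalAtlas (𝓡 4) ∞ M) {x : M}
    (hx : x ∈ φ.source) {g : M → ℝ} (hg : DifferentiableAt ℝ (fun z => g (φ.symm z)) (φ x))
    (p : Fin 4) : mvfderiv (𝓡 4) g x (ϑ.frame p x) =
      fderiv ℝ (fun z => g (φ.symm z)) (φ x) (ϑ.vec φ p (φ x)) := by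
  have h1 : g =ᶠ[𝓝 x] (fun z => g (φ.symm z)) ∘ φ := by
    filter_upwards [φ.open_source.mem_nhds hx] with z hz
    simp [φ.left_inv hz]
  have h2 : mfderiv (𝓡 4) 𝓘(ℝ, ℝ) g x = mfderiv (𝓡 4) 𝓘(ℝ, ℝ) ((fun z => g (φ.symm z)) ∘ φ) x :=
    h1.mfderiv_eq
  have h3 := mfderiv_comp (I := 𝓡 4) (I' := 𝓘(ℝ, E4)) (I'' := 𝓘(ℝ, ℝ)) x
    (g := fun z => g (φ.symm z)) (f := φ) hg.mdifferentiableAt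
    ((mdifferentiable_of_mem_maximalAtlas hφ).mdifferentiableAt hx)
  rw [mfderiv_eq_fderiv] at h3
  have h4 : ϑ.vec φ p (φ x) = (mfderiv (𝓡 4) 𝓘(ℝ, E4) φ x : E4 →L[ℝ] E4) (ϑ.frame p x) := by
    unfold vec
    rw [φ.left_inv hx]
  rw [h4]
  exact congrArg (fun T : E4 →L[ℝ] ℝ => T (ϑ.frame p x)) (h2.trans h3)

variable [IsManifold (𝓡 4) ∞ M]

/-- Smoothness of the coframe is given in preferred charts only; the transition map carries it to
any chart of the maximal atlas. -/
theorem contDiffAt_cov (hφ : φ ∈ IsManifold.maximalAtlas (𝓡 4) ∞ M) {y : E4}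
    (hy : y ∈ φ.target) (a : Fin 4) : ContDiffAt ℝ ∞ (ϑ.cov φ a) y := by
  set x := φ.symm y with hx
  set ψ := chartAt E4 x
  have hψ : ψ ∈ IsManifold.maximalAtlas (𝓡 4) ∞ M := IsManifold.chart_mem_maximalAtlas x
  have hxψ : φ.symm y ∈ ψ.source := mem_chart_source E4 x
  have h1 : ContDiffAt ℝ ∞ (ϑ.cov ψ a) (ψ x) := by
    have h2 := ϑ.smooth a x
    rw [target_extChartAt_eq] at h2
    have h3 := (h2 (ψ x) (ψ.map_source hxψ)).contDiffAt (ψ.open_target.mem_nhds (ψ.map_source hxψ))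
    have h4 := (covectorEquiv).symm.contDiff.contDiffAt.comp
      (ψ x) h3
    refine h4.congr_of_eventuallyEq (Eventually.of_forall fun z => ?_)
    simp only [Function.comp, formInChart_eq_pullChart, pullChart_oneForm]
    exact (LinearIsometryEquiv.symm_apply_apply _ _).symm
  have hτ := contDiffAt_transition hφ hψ hy hxψ
  have h4 : ContDiffAt ℝ ∞ (fun z => ϑ.cov ψ a ((ψ ∘ φ.symm) z)) y :=
    ContDiffAt.comp (g := ϑ.cov ψ a) y h1 hτ
  have h5 : ContDiffAt ℝ ∞ (fun z => (ϑ.cov ψ a ((ψ ∘ φ.symm) z)).comp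
      (fderiv ℝ (ψ ∘ φ.symm) z)) y :=
    h4.clm_comp (hτ.fderiv_right (by simp))
  refine h5.congr_of_eventuallyEq ?_
  filter_upwards [eventually_symm_mem_source hy hxψ] with z hz
  exact ϑ.cov_transition hφ hψ hz.1 hz.2 a

/-- The frame is the inverse of the coframe applied to constant vectors, and inversion is smooth at
an invertible operator. -/
theorem contDiffAt_vec (hφ : φ ∈ IsManifold.maximalAtlas (𝓡 4) ∞ M) {y : E4}
    (hy : y ∈ φ.target) (b : Fin 4) : ContDiffAt ℝ ∞ (ϑ.vec φ b) y := by
  have h0 : ContDiffOn ℝ ∞ (fun z => ContinuousLinearMap.pi fun a => ϑ.cov φ a z) φ.target := by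
    rw [contDiffOn_clm_apply]
    intro v
    exact contDiffOn_pi.2 fun a z hz =>
      ((ϑ.contDiffAt_cov hφ hz a).clm_apply contDiffAt_const).contDiffWithinAt
  have h1 := h0.contDiffAt (φ.open_target.mem_nhds hy)
  have h2 := contDiffAt_map_inverse (n := ∞) (ϑ.covEquiv hφ hy)
  rw [ϑ.coe_covEquiv hφ hy] at h2
  have h3 := (ContDiffAt.comp y h2 h1).clm_apply
    (contDiffAt_const (c := (Pi.single b 1 : Fin 4 → ℝ)))
  refine h3.congr_of_eventuallyEq ?_
  filter_upwards [φ.open_target.mem_nhds hy] with z hz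
  exact ϑ.vec_eq_inverse hφ hz b

theorem contDiffAt_pullChart_oneForm (hφ : φ ∈ IsManifold.maximalAtlas (𝓡 4) ∞ M) {y : E4}
    (hy : y ∈ φ.target) (a : Fin 4) : ContDiffAt ℝ ∞ (pullChart φ (oneForm (ϑ.form a))) y :=
  (covectorEquiv).contDiff.contDiffAt.comp y
    (ϑ.contDiffAt_cov hφ hy a)

theorem differentiableAt_pullChart_oneForm (hφ : φ ∈ IsManifold.maximalAtlas (𝓡 4) ∞ M) {y : E4}
    (hy : y ∈ φ.target) (a : Fin 4) :
    DifferentiableAt ℝ (pullChart φ (oneForm (ϑ.form a))) y :=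
  (ϑ.contDiffAt_pullChart_oneForm hφ hy a).differentiableAt (by simp)

theorem differentiableAt_vec (hφ : φ ∈ IsManifold.maximalAtlas (𝓡 4) ∞ M) {y : E4}
    (hy : y ∈ φ.target) (a : Fin 4) : DifferentiableAt ℝ (ϑ.vec φ a) y :=
  (ϑ.contDiffAt_vec hφ hy a).differentiableAt (by simp)

theorem dForm_frame {p : ℕ} (w : DForm M p) (hφ : φ ∈ IsManifold.maximalAtlas (𝓡 4) ∞ M) {y : E4}
    (hy : y ∈ φ.target) (hw : DifferentiableAt ℝ (pullChart φ w) y) (c : Fin (p + 1) → Fin 4) :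
    dForm w (φ.symm y) (fun i => ϑ.frame (c i) (φ.symm y)) =
      extDeriv (pullChart φ w) y fun i => ϑ.vec φ (c i) y := by
  have hw' : DifferentiableAt ℝ (pullChart φ w) (φ (φ.symm y)) := by rwa [φ.right_inv hy]
  have h := dForm_eq_of_mem_maximalAtlas w hφ (φ.map_target hy) hw'
  rw [h, φ.right_inv hy]
  rfl

theorem C_symm (hφ : φ ∈ IsManifold.maximalAtlas (𝓡 4) ∞ M) {y : E4}
    (hy : y ∈ φ.target) (a b c : Fin 4) : ϑ.C a b c (φ.symm y) =
      extDeriv (pullChart φ (oneForm (ϑ.form a))) y ![ϑ.vec φ b y, ϑ.vec φ c y] := by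
  have h := ϑ.dForm_frame (oneForm (ϑ.form a)) hφ hy
    (ϑ.differentiableAt_pullChart_oneForm hφ hy a) ![b, c]
  have e1 : (fun i => ϑ.frame (![b, c] i) (φ.symm y)) =
      ![ϑ.frame b (φ.symm y), ϑ.frame c (φ.symm y)] := by
    funext i; fin_cases i <;> rfl
  have e2 : (fun i => ϑ.vec φ (![b, c] i) y) = ![ϑ.vec φ b y, ϑ.vec φ c y] := by
    funext i; fin_cases i <;> rfl
  rw [e2] at h
  rw [← h]
  exact congrArg (dForm (oneForm (ϑ.form a)) (φ.symm y)) e1.symm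

/-- In a chart `Cᵃ_{bc} = D_b ϑᵃ(e_c) - D_c ϑᵃ(e_b)` with the derivatives of `ϑᵃ` only. -/
theorem C_symm_eq_fderiv (hφ : φ ∈ IsManifold.maximalAtlas (𝓡 4) ∞ M) {y : E4}
    (hy : y ∈ φ.target) (a b c : Fin 4) : ϑ.C a b c (φ.symm y) =
      fderiv ℝ (ϑ.cov φ a) y (ϑ.vec φ b y) (ϑ.vec φ c y) -
        fderiv ℝ (ϑ.cov φ a) y (ϑ.vec φ c y) (ϑ.vec φ b y) := by
  have hd : ∀ v, fderiv ℝ (fun z => ϑ.cov φ a z v) y =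
      (ContinuousLinearMap.apply ℝ ℝ v).comp (fderiv ℝ (ϑ.cov φ a) y) := fun v =>
    ((ContinuousLinearMap.apply ℝ ℝ v).hasFDerivAt.comp y
      ((ϑ.contDiffAt_cov hφ hy a).differentiableAt (by simp)).hasFDerivAt).fderiv
  -- The arguments are frozen at y, so no derivative of the frame enters. Smoothness of `C`
  -- therefore follows from that of the coframe and the frame alone.
  rw [ϑ.C_symm hφ hy, extDeriv_apply (ϑ.differentiableAt_pullChart_oneForm hφ hy a)]
  rw [Fin.sum_univ_two]
  have e1 : (fun z => pullChart φ (oneForm (ϑ.form a)) z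
      ((0 : Fin 2).removeNth ![ϑ.vec φ b y, ϑ.vec φ c y])) =
      fun z => ϑ.cov φ a z (ϑ.vec φ c y) := rfl
  have e2 : (fun z => pullChart φ (oneForm (ϑ.form a)) z
      ((1 : Fin 2).removeNth ![ϑ.vec φ b y, ϑ.vec φ c y])) =
      fun z => ϑ.cov φ a z (ϑ.vec φ b y) := rfl
  rw [e1, e2, hd, hd]
  simp [sub_eq_add_neg]

theorem contDiffAt_C_symm (hφ : φ ∈ IsManifold.maximalAtlas (𝓡 4) ∞ M) {y : E4}
    (hy : y ∈ φ.target) (a b c : Fin 4) :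
    ContDiffAt ℝ ∞ (fun z => ϑ.C a b c (φ.symm z)) y := by
  have h : ∀ b, ContDiffAt ℝ ∞ (ϑ.vec φ b) y := ϑ.contDiffAt_vec hφ hy
  have hd : ContDiffAt ℝ ∞ (fderiv ℝ (ϑ.cov φ a)) y :=
    (ϑ.contDiffAt_cov hφ hy a).fderiv_right (by simp)
  refine (((hd.clm_apply (h b)).clm_apply (h c)).sub
    ((hd.clm_apply (h c)).clm_apply (h b))).congr_of_eventuallyEq ?_
  filter_upwards [φ.open_target.mem_nhds hy] with z hz
  exact ϑ.C_symm_eq_fderiv hφ hz a b c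

theorem differentiableAt_C_symm (hφ : φ ∈ IsManifold.maximalAtlas (𝓡 4) ∞ M) {y : E4}
    (hy : y ∈ φ.target) (a b c : Fin 4) :
    DifferentiableAt ℝ (fun z => ϑ.C a b c (φ.symm z)) y :=
  (ϑ.contDiffAt_C_symm hφ hy a b c).differentiableAt (by simp)

theorem fderiv_C_symm (hφ : φ ∈ IsManifold.maximalAtlas (𝓡 4) ∞ M) {x : M}
    (hx : x ∈ φ.source) (a b c p : Fin 4) :
    fderiv ℝ (fun z => ϑ.C a b c (φ.symm z)) (φ x) (ϑ.vec φ p (φ x)) = ϑ.B a b c p x :=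
  (ϑ.mvfderiv_frame hφ hx (ϑ.differentiableAt_C_symm hφ (φ.map_source hx) a b c) p).symm

/-- `[e_b, e_c] = - Cᵏ_{bc} e_k`. -/
theorem lieBracket_vec (hφ : φ ∈ IsManifold.maximalAtlas (𝓡 4) ∞ M) {y : E4}
    (hy : y ∈ φ.target) (b c : Fin 4) :
    VectorField.lieBracket ℝ (ϑ.vec φ b) (ϑ.vec φ c) y =
      ∑ k, (-ϑ.C k b c (φ.symm y)) • ϑ.vec φ k y := by
  rw [ϑ.eq_sum_cov_smul_vec hφ hy (VectorField.lieBracket ℝ (ϑ.vec φ b) (ϑ.vec φ c) y)]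
  refine Finset.sum_congr rfl fun k _ => ?_
  congr 1
  have hv : ∀ i, DifferentiableAt ℝ (ϑ.vec φ i) y := ϑ.differentiableAt_vec hφ hy
  have hθ : DifferentiableAt ℝ (ϑ.cov φ k) y :=
    (ϑ.contDiffAt_cov hφ hy k).differentiableAt (by simp)
  -- The pairing ϑᵏ(e_i) is constant, so its derivative along e_c and e_b vanishes. This trades
  -- derivatives of the frame for derivatives of the coframe.
  have hz : ∀ i, fderiv ℝ (ϑ.cov φ k) y (ϑ.vec φ c y) (ϑ.vec φ i y) +
      ϑ.cov φ k y (fderiv ℝ (ϑ.vec φ i) y (ϑ.vec φ c y)) = 0 ∧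
      fderiv ℝ (ϑ.cov φ k) y (ϑ.vec φ b y) (ϑ.vec φ i y) +
      ϑ.cov φ k y (fderiv ℝ (ϑ.vec φ i) y (ϑ.vec φ b y)) = 0 := by
    intro i
    have h1 : (fun z => ϑ.cov φ k z (ϑ.vec φ i z)) =ᶠ[𝓝 y] fun _ => if k = i then 1 else 0 := by
      filter_upwards [φ.open_target.mem_nhds hy] with z hz
      exact ϑ.cov_vec hφ hz k i
    have h2 := h1.fderiv_eq (𝕜 := ℝ)
    rw [(hθ.hasFDerivAt.clm_apply (hv i).hasFDerivAt).fderiv, fderiv_fun_const] at h2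
    have h3 := fun v => congrArg (fun T : E4 →L[ℝ] ℝ => T v) h2
    constructor
    · simpa [add_comm] using h3 (ϑ.vec φ c y)
    · simpa [add_comm] using h3 (ϑ.vec φ b y)
  rw [VectorField.lieBracket, map_sub, ϑ.C_symm_eq_fderiv hφ hy]
  linarith [(hz b).1, (hz c).2]

/-- The exterior derivative in terms of the frame. -/
theorem dForm_frame_eq {p : ℕ} (w : DForm M (p + 1)) (hφ : φ ∈ IsManifold.maximalAtlas (𝓡 4) ∞ M)
    {x : M} (hx : x ∈ φ.source) (hw : DifferentiableAt ℝ (pullChart φ w) (φ x))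
    (c : Fin (p + 2) → Fin 4) :
    dForm w x (fun i => ϑ.frame (c i) x) =
      (∑ i, (-1 : ℝ) ^ i.val * fderiv ℝ (fun z => w (φ.symm z)
        fun l => ϑ.frame (i.removeNth c l) (φ.symm z)) (φ x) (ϑ.vec φ (c i) (φ x))) +
      ∑ i : Fin (p + 1), ∑ j ≥ i, (-1 : ℝ) ^ (i + j : ℕ) * ∑ k,
        ϑ.C k (c i.castSucc) (c j.succ) x *
          w x fun l => ϑ.frame (Fin.cons (α := fun _ => Fin 4) k
            (j.removeNth <| i.castSucc.removeNth c) l) x := by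
  have hy := φ.map_source hx
  have h := ϑ.dForm_frame w hφ hy hw c
  rw [extDeriv_apply_vectorField hw (fun i => ϑ.differentiableAt_vec hφ hy (c i))] at h
  rw [φ.left_inv hx] at h
  rw [h, sub_eq_add_neg, ← Finset.sum_neg_distrib]
  congr 1
  · refine Finset.sum_congr rfl fun i _ => ?_
    simp only [zsmul_eq_mul, Int.cast_pow, Int.cast_neg, Int.cast_one]
    congr 2
    apply Filter.EventuallyEq.fderiv_eq
    filter_upwards [φ.open_target.mem_nhds hy] with z hz
    exact ϑ.pullChart_vec w hφ hz (i.removeNth c)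
  -- Two minus signs cancel: the one before the bracket sum and the one in [e_b, e_c] = -Cᵏ_{bc}
  -- e_k.
  · refine Finset.sum_congr rfl fun i _ => ?_
    rw [← Finset.sum_neg_distrib]
    refine Finset.sum_congr rfl fun j _ => ?_
    simp only [zsmul_eq_mul, Int.cast_pow, Int.cast_neg, Int.cast_one]
    rw [← mul_neg]
    congr 1
    rw [ϑ.lieBracket_vec hφ hy, φ.left_inv hx]
    -- Currying the first slot makes linearity in the bracket available to `map_sum` and `map_smul`.
    have h1 : ∀ (r : Fin p → Fin 4) (u : E4), pullChart φ w (φ x) (Matrix.vecCons u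
        fun l => ϑ.vec φ (r l) (φ x)) =
        (pullChart φ w (φ x)).toMultilinearMap.curryLeft u
          (fun l => ϑ.vec φ (r l) (φ x)) := fun r u => rfl
    refine (congrArg Neg.neg (h1 (j.removeNth <| i.castSucc.removeNth c) _)).trans ?_
    rw [map_sum, sum_apply, ← Finset.sum_neg_distrib]
    refine Finset.sum_congr rfl fun k _ => ?_
    rw [map_smul, smul_apply, ← h1]
    rw [smul_eq_mul, neg_mul, neg_neg]
    congr 1
    have h2 := ϑ.pullChart_vec w hφ hy
      (Fin.cons (α := fun _ => Fin 4) k (j.removeNth <| i.castSucc.removeNth c))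
    rw [φ.left_inv hx] at h2
    rw [← h2]
    congr 1
    funext l
    refine Fin.cases ?_ (fun l => ?_) l <;> rfl

end Coframe

/-! ### The Levi-Civita symbol -/

/-- The Vandermonde matrix of c is the 0-1 matrix of c times the Vandermonde matrix of 0, 1, 2, 3,
whose determinant is 12. The resulting polynomial lets `simp` evaluate ε on literal indices. -/
theorem leviCivita_eq (c : Fin 4 → Fin 4) :
    leviCivita c = (((c 1 : ℕ) : ℝ) - (c 0 : ℕ)) * (((c 2 : ℕ) : ℝ) - (c 0 : ℕ)) *
      (((c 3 : ℕ) : ℝ) - (c 0 : ℕ)) * (((c 2 : ℕ) : ℝ) - (c 1 : ℕ)) *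
      (((c 3 : ℕ) : ℝ) - (c 1 : ℕ)) * (((c 3 : ℕ) : ℝ) - (c 2 : ℕ)) / 12 := by
  have hdet : ∀ v : Fin 4 → ℝ, (Matrix.vandermonde v).det =
      (v 1 - v 0) * (v 2 - v 0) * (v 3 - v 0) * (v 2 - v 1) * (v 3 - v 1) * (v 3 - v 2) := by
    intro v
    rw [Matrix.det_vandermonde, Fin.prod_univ_four]
    have h0 : Finset.Ioi (0 : Fin 4) = {1, 2, 3} := by decide
    have h1 : Finset.Ioi (1 : Fin 4) = {2, 3} := by decide
    have h2 : Finset.Ioi (2 : Fin 4) = {3} := by decide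
    have h3 : Finset.Ioi (3 : Fin 4) = ∅ := by decide
    rw [h0, h1, h2, h3, Finset.prod_insert (by decide), Finset.prod_pair (by decide),
      Finset.prod_pair (by decide), Finset.prod_singleton, Finset.prod_empty]
    ring
  have hmul : Matrix.vandermonde (fun i => ((c i : ℕ) : ℝ)) =
      (Matrix.of fun i j : Fin 4 => if c i = j then (1 : ℝ) else 0) *
        Matrix.vandermonde fun i : Fin 4 => ((i : ℕ) : ℝ) := by
    ext i j
    simp [Matrix.mul_apply, Matrix.vandermonde_apply]
  have h := congrArg Matrix.det hmul
  rw [Matrix.det_mul, hdet, hdet] at h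
  have h12 : ((((1 : Fin 4) : ℕ) : ℝ) - ((0 : Fin 4) : ℕ)) *
      ((((2 : Fin 4) : ℕ) : ℝ) - ((0 : Fin 4) : ℕ)) * ((((3 : Fin 4) : ℕ) : ℝ) - ((0 : Fin 4) : ℕ)) *
      ((((2 : Fin 4) : ℕ) : ℝ) - ((1 : Fin 4) : ℕ)) * ((((3 : Fin 4) : ℕ) : ℝ) - ((1 : Fin 4) : ℕ)) *
      ((((3 : Fin 4) : ℕ) : ℝ) - ((2 : Fin 4) : ℕ)) = 12 := by norm_num
  rw [h12] at h
  rw [h, leviCivita]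
  ring

theorem leviCivita_comp_perm (c : Fin 4 → Fin 4) (σ : Equiv.Perm (Fin 4)) :
    leviCivita (fun i => c (σ i)) = Equiv.Perm.sign σ * leviCivita c := by
  unfold leviCivita
  rw [← Matrix.det_permute]
  rfl

theorem leviCivita_append_comp_perm {p q : ℕ} (h : 4 = p + q) (a : Fin p → Fin 4)
    (c : Fin q → Fin 4) (σ : Equiv.Perm (Fin q)) :
    leviCivita (fun i => Fin.append a (c ∘ σ) (Fin.cast h i)) =
      Equiv.Perm.sign σ * leviCivita (fun i => Fin.append a c (Fin.cast h i)) := by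
  set e : Fin p ⊕ Fin q ≃ Fin 4 := finSumFinEquiv.trans (finCongr h.symm) with he
  have h1 := leviCivita_comp_perm (fun i => Fin.append a c (Fin.cast h i))
    (e.permCongr (Equiv.Perm.sumCongr 1 σ))
  rw [Equiv.Perm.sign_permCongr, Equiv.Perm.sign_sumCongr, Equiv.Perm.sign_one, one_mul] at h1
  rw [← h1]
  congr 1
  funext i
  obtain ⟨s, rfl⟩ := e.surjective i
  rcases s with s | s
  · simp [he, Equiv.permCongr_apply]
  · simp [he, Equiv.permCongr_apply]

/-- The determinant is supported on the rearrangements c ∘ σ, with weight sign σ. As ε changes by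
the same sign, each of the q! permutations contributes equally; this cancels the 1/q! in `hodge`. -/
theorem sum_leviCivita_mul_det {p q : ℕ} (h : 4 = p + q) (a : Fin p → Fin 4) (c : Fin q → Fin 4) :
    ∑ b : Fin q → Fin 4, leviCivita (fun i => Fin.append a b (Fin.cast h i)) *
      Matrix.det (Matrix.of fun j i : Fin q => if b i = c j then (1 : ℝ) else 0) =
    q.factorial * leviCivita (fun i => Fin.append a c (Fin.cast h i)) := by
  have hdet : ∀ b : Fin q → Fin 4,
      Matrix.det (Matrix.of fun j i : Fin q => if b i = c j then (1 : ℝ) else 0) =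
      ∑ σ : Equiv.Perm (Fin q), ((Equiv.Perm.sign σ : ℤ) : ℝ) * if b = c ∘ σ then 1 else 0 := by
    intro b
    rw [Matrix.det_apply']
    refine Finset.sum_congr rfl fun σ _ => ?_
    congr 1
    simp only [Matrix.of_apply]
    rw [Finset.prod_ite_zero]
    simp [funext_iff]
  simp_rw [hdet, Finset.mul_sum]
  rw [Finset.sum_comm]
  have hs : ∀ σ : Equiv.Perm (Fin q), ∑ b : Fin q → Fin 4,
      leviCivita (fun i => Fin.append a b (Fin.cast h i)) *
        (((Equiv.Perm.sign σ : ℤ) : ℝ) * if b = c ∘ σ then 1 else 0) =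
      leviCivita (fun i => Fin.append a c (Fin.cast h i)) := by
    intro σ
    simp only [mul_ite, mul_one, mul_zero, Finset.sum_ite_eq', Finset.mem_univ, if_true]
    rw [leviCivita_append_comp_perm]
    have : (((Equiv.Perm.sign σ : ℤ) : ℝ)) * (((Equiv.Perm.sign σ : ℤ) : ℝ)) = 1 := by
      rcases Int.units_eq_one_or (Equiv.Perm.sign σ) with h | h <;> simp [h]
    linear_combination leviCivita (fun i => Fin.append a c (Fin.cast h i)) * this
  rw [Finset.sum_congr rfl fun σ _ => hs σ]
  simp [Fintype.card_perm]

theorem sum_univ_fun_succ {n : ℕ} (f : (Fin (n + 1) → Fin 4) → ℝ) :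
    ∑ c, f c = ∑ i, ∑ c : Fin n → Fin 4, f (Matrix.vecCons i c) := by
  rw [← (Fin.consEquiv fun _ : Fin (n + 1) => Fin 4).sum_comp, Fintype.sum_prod_type]
  rfl

/-! ### Frame components and regularity of the Hodge dual -/

namespace Coframe

variable {M : Type*} [TopologicalSpace M] [ChartedSpace E4 M] (ϑ : Coframe M)

theorem wedge_frame {q : ℕ} (b c : Fin q → Fin 4) (x : M) :
    ϑ.wedge b x (fun i => ϑ.frame (c i) x) =
      Matrix.det (Matrix.of fun j i : Fin q => if b i = c j then (1 : ℝ) else 0) := by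
  change Matrix.det (fun j i : Fin q => ϑ.form (b i) x (ϑ.frame (c j) x)) = _
  congr 1
  ext j i
  exact ϑ.form_frame (c j) (b i) x

theorem hodge_apply {p q : ℕ} (h : 4 = p + q) (α : DForm M p) (x : M) (v : Fin q → E4) :
    (ϑ.hodge h α x : E4 [⋀^Fin q]→L[ℝ] ℝ) v =
      ((p.factorial : ℝ) * (q.factorial : ℝ))⁻¹ *
      ∑ a : Fin p → Fin 4, ∑ b : Fin q → Fin 4,
        ((∏ i, sgn (a i)) * α x (fun i => ϑ.frame (a i) x) *
          leviCivita (fun i => Fin.append a b (Fin.cast h i))) *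
            (ϑ.wedge b x : E4 [⋀^Fin q]→L[ℝ] ℝ) v := by
  refine (ContinuousAlternatingMap.smul_apply _ _ _).trans ?_
  rw [smul_eq_mul]
  congr 1
  refine (ContinuousAlternatingMap.sum_apply _ _).trans ?_
  refine Finset.sum_congr rfl fun a _ => ?_
  exact ContinuousAlternatingMap.sum_apply _ _

/-- The components of the Hodge dual. -/
theorem hodge_frame {p q : ℕ} (h : 4 = p + q) (α : DForm M p) (x : M) (c : Fin q → Fin 4) :
    ϑ.hodge h α x (fun i => ϑ.frame (c i) x) =
      (p.factorial : ℝ)⁻¹ * ∑ a : Fin p → Fin 4,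
        (∏ i, sgn (a i)) * α x (fun i => ϑ.frame (a i) x) *
          leviCivita (fun i => Fin.append a c (Fin.cast h i)) := by
  refine (ϑ.hodge_apply h α x _).trans ?_
  have hq : (q.factorial : ℝ) ≠ 0 := by positivity
  have h1 : ∀ a : Fin p → Fin 4, ∑ b : Fin q → Fin 4,
      ((∏ i, sgn (a i)) * α x (fun i => ϑ.frame (a i) x) *
        leviCivita (fun i => Fin.append a b (Fin.cast h i))) *
          (ϑ.wedge b x : E4 [⋀^Fin q]→L[ℝ] ℝ) (fun i => ϑ.frame (c i) x) =
      q.factorial * ((∏ i, sgn (a i)) * α x (fun i => ϑ.frame (a i) x) *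
          leviCivita (fun i => Fin.append a c (Fin.cast h i))) := by
    intro a
    rw [mul_left_comm, ← sum_leviCivita_mul_det h a c, Finset.mul_sum]
    refine Finset.sum_congr rfl fun b _ => ?_
    rw [mul_assoc]
    congr 2
    exact ϑ.wedge_frame b c x
  rw [Finset.sum_congr rfl fun a _ => h1 a, ← Finset.mul_sum, mul_inv]
  field_simp

variable [IsManifold (𝓡 4) ∞ M] {φ : OpenPartialHomeomorph M E4}

/-- In a chart the dual is a finite sum of components of α times wedges of coframe covectors, and
those wedges are already differentiable. -/
theorem differentiableAt_pullChart_hodge {p q : ℕ} (h : 4 = p + q) (α : DForm M p)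
    (hφ : φ ∈ IsManifold.maximalAtlas (𝓡 4) ∞ M) {y : E4} (hy : y ∈ φ.target)
    (hα : ∀ a : Fin p → Fin 4,
      DifferentiableAt ℝ (fun z => α (φ.symm z) fun i => ϑ.frame (a i) (φ.symm z)) y) :
    DifferentiableAt ℝ (pullChart φ (ϑ.hodge h α)) y := by
  have h1 : pullChart φ (ϑ.hodge h α) = fun z => ((p.factorial : ℝ) * (q.factorial : ℝ))⁻¹ •
      ∑ a : Fin p → Fin 4, ∑ b : Fin q → Fin 4,
        ((∏ i, sgn (a i)) * α (φ.symm z) (fun i => ϑ.frame (a i) (φ.symm z)) *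
          leviCivita (fun i => Fin.append a b (Fin.cast h i))) •
            (detForm q).compContinuousLinearMap
              (ContinuousLinearMap.pi fun i => ϑ.cov φ (b i) z) := by
    funext z
    ext v
    refine (ϑ.hodge_apply h α (φ.symm z) _).trans ?_
    rw [ContinuousAlternatingMap.smul_apply, ContinuousAlternatingMap.sum_apply, smul_eq_mul]
    congr 1
    refine Finset.sum_congr rfl fun a _ => ?_
    rw [ContinuousAlternatingMap.sum_apply]
    rfl
  rw [h1]
  have hpi : ∀ b : Fin q → Fin 4,
      DifferentiableAt ℝ (fun z => ContinuousLinearMap.pi fun i => ϑ.cov φ (b i) z) y := by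
    intro b
    have h0 : ContDiffOn ℝ ∞ (fun z => ContinuousLinearMap.pi fun i => ϑ.cov φ (b i) z)
        φ.target := by
      rw [contDiffOn_clm_apply]
      intro v
      exact contDiffOn_pi.2 fun i z hz =>
        ((ϑ.contDiffAt_cov hφ hz (b i)).clm_apply contDiffAt_const).contDiffWithinAt
    exact (h0.contDiffAt (φ.open_target.mem_nhds hy)).differentiableAt (by simp)
  refine DifferentiableAt.fun_const_smul (F := E4 [⋀^Fin q]→L[ℝ] ℝ)
    (DifferentiableAt.fun_sum fun a _ => DifferentiableAt.fun_sum fun b _ => ?_) _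
  exact (((hα a).const_mul _).mul_const _).smul
    ((differentiableAt_const (detForm q)).continuousAlternatingMapCompContinuousLinearMap (hpi b))

end Coframe

/-! ### Contractions of the Levi-Civita symbol with explicit signs -/

theorem leviCivita_eq_zero_of_not_injective {c : Fin 4 → Fin 4} (hc : ¬ Function.Injective c) :
    leviCivita c = 0 := by
  obtain ⟨i, j, hij, hne⟩ : ∃ i j, c i = c j ∧ i ≠ j := by
    simpa [Function.Injective] using hc
  refine Matrix.det_zero_of_row_eq hne ?_
  funext k
  simp [hij]

theorem leviCivita_coe_perm (σ : Equiv.Perm (Fin 4)) : leviCivita σ = Equiv.Perm.sign σ := by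
  have h := leviCivita_comp_perm id σ
  have h1 : leviCivita id = 1 := by rw [leviCivita_eq]; norm_num
  rw [h1, mul_one] at h
  exact h

theorem exists_perm_of_injective {c : Fin 4 → Fin 4} (hc : Function.Injective c) :
    ∃ σ : Equiv.Perm (Fin 4), c = σ :=
  ⟨Equiv.ofBijective c (Finite.injective_iff_bijective.1 hc), rfl⟩

theorem sum_leviCivita_sq : ∑ c : Fin 4 → Fin 4, leviCivita c * leviCivita c = 24 := by
  have h := sum_leviCivita_mul_det (p := 0) (q := 4) (by norm_num) Fin.elim0 id
  have h1 : ∀ b : Fin 4 → Fin 4,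
      (fun i => Fin.append Fin.elim0 b (Fin.cast (by norm_num : 4 = 0 + 4) i)) = b := by
    intro b
    funext i
    simp [Fin.elim0_append]
  have h2 : ∀ b : Fin 4 → Fin 4,
      Matrix.det (Matrix.of fun j i : Fin 4 => if b i = id j then (1 : ℝ) else 0) =
        leviCivita b := by
    intro b
    rw [← Matrix.det_transpose]
    rfl
  simp only [h1, h2] at h
  rw [h, show leviCivita id = 1 by rw [leviCivita_eq]; norm_num]
  norm_num [Nat.factorial]

/-- On a permutation the product is det η = -1; otherwise ε vanishes. -/
theorem prod_sgn_mul_leviCivita (c : Fin 4 → Fin 4) :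
    (∏ i, sgn (c i)) * leviCivita c = -leviCivita c := by
  by_cases hc : Function.Injective c
  · obtain ⟨σ, rfl⟩ := exists_perm_of_injective hc
    rw [Equiv.prod_comp σ sgn, Fin.prod_univ_four]
    simp [sgn]
  · simp [leviCivita_eq_zero_of_not_injective hc]

theorem alternating_comp_eq_leviCivita {E : Type*} [AddCommGroup E] [Module ℝ E]
    (f : E [⋀^Fin 4]→ₗ[ℝ] ℝ) (v : Fin 4 → E) (c : Fin 4 → Fin 4) :
    f (fun i => v (c i)) = leviCivita c * f v := by
  by_cases hc : Function.Injective c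
  · obtain ⟨σ, rfl⟩ := exists_perm_of_injective hc
    rw [leviCivita_coe_perm]
    have h := f.map_perm v σ
    rw [Units.smul_def, zsmul_eq_mul] at h
    exact h
  · obtain ⟨i, j, hij, hne⟩ : ∃ i j, c i = c j ∧ i ≠ j := by
      simpa [Function.Injective] using hc
    rw [leviCivita_eq_zero_of_not_injective hc, zero_mul]
    exact f.map_eq_zero_of_eq _ (by rw [hij]) hne

theorem leviCivita_vec (i j k l : Fin 4) :
    leviCivita ![i, j, k, l] = (((j : ℕ) : ℝ) - (i : ℕ)) * (((k : ℕ) : ℝ) - (i : ℕ)) *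
      (((l : ℕ) : ℝ) - (i : ℕ)) * (((k : ℕ) : ℝ) - (j : ℕ)) *
      (((l : ℕ) : ℝ) - (j : ℕ)) * (((l : ℕ) : ℝ) - (k : ℕ)) / 12 :=
  leviCivita_eq _

/-- The Hodge dual of an antisymmetric matrix. -/
def starTable (K : Fin 4 → Fin 4 → ℝ) : Fin 4 → Fin 4 → ℝ :=
  ![![0, K 2 3, -K 1 3, K 1 2], ![-K 2 3, 0, -K 0 3, K 0 2],
    ![K 1 3, K 0 3, 0, -K 0 1], ![-K 1 2, -K 0 2, K 0 1, 0]]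

theorem sum_leviCivita_eq_starTable {K : Fin 4 → Fin 4 → ℝ} (hK : ∀ i j, K i j = -K j i)
    (m n : Fin 4) :
    (2 : ℝ)⁻¹ * ∑ i, ∑ j, sgn i * sgn j * K i j * leviCivita ![i, j, m, n] =
      starTable K m n := by
  have h10 := hK 1 0
  have h20 := hK 2 0
  have h30 := hK 3 0
  have h21 := hK 2 1
  have h31 := hK 3 1
  have h32 := hK 3 2
  fin_cases m <;> fin_cases n <;>
    simp [Fin.sum_univ_four, leviCivita_vec, sgn, starTable] <;> linarith

/-- The components of the Hodge dual of a `3`-form. -/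
theorem sum_leviCivita_three {F : Fin 4 → Fin 4 → Fin 4 → ℝ}
    (h1 : ∀ i j k, F i j k = -F j i k) (h2 : ∀ i j k, F i j k = -F i k j) (b : Fin 4) :
    (6 : ℝ)⁻¹ * ∑ i, ∑ j, ∑ k, sgn i * sgn j * sgn k * F i j k * leviCivita ![i, j, k, b] =
      ![F 1 2 3, F 0 2 3, -F 0 1 3, F 0 1 2] b := by
  have key : ∀ i j k, F j i k = -F i j k ∧ F i k j = -F i j k ∧ F j k i = F i j k ∧
      F k i j = F i j k ∧ F k j i = -F i j k := by
    intro i j k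
    refine ⟨by linarith [h1 i j k], by linarith [h2 i j k], ?_, ?_, ?_⟩
    · linarith [h2 j k i, h1 i j k]
    · linarith [h1 k i j, h2 i j k]
    · linarith [h1 k j i, h2 j k i, h1 i j k]
  obtain ⟨a1, a2, a3, a4, a5⟩ := key 0 1 2
  obtain ⟨b1, b2, b3, b4, b5⟩ := key 0 1 3
  obtain ⟨c1, c2, c3, c4, c5⟩ := key 0 2 3
  obtain ⟨d1, d2, d3, d4, d5⟩ := key 1 2 3
  fin_cases b <;>
    simp [Fin.sum_univ_four, leviCivita_vec, sgn] <;> linarith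

/-! ### Frame components of forms, duals and differentials -/

namespace Coframe

variable {M : Type*} [TopologicalSpace M] [ChartedSpace E4 M] (ϑ : Coframe M)

/-- The components of a form with respect to the frame. -/
def coeff {p : ℕ} (w : DForm M p) (c : Fin p → Fin 4) (x : M) : ℝ :=
  w x fun i => ϑ.frame (c i) x

theorem coeff_comp_swap {p : ℕ} (w : DForm M p) (c : Fin p → Fin 4) (x : M) {i j : Fin p}
    (hij : i ≠ j) : ϑ.coeff w (c ∘ Equiv.swap i j) x = -ϑ.coeff w c x :=
  (w x).toAlternatingMap.map_swap (fun l => ϑ.frame (c l) x) hij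

theorem coeff_two_swap (w : DForm M 2) (i j : Fin 4) (x : M) :
    ϑ.coeff w ![i, j] x = -ϑ.coeff w ![j, i] x := by
  rw [← ϑ.coeff_comp_swap w ![j, i] x (i := 0) (j := 1) (by decide)]
  congr 1
  funext l
  fin_cases l <;> rfl

theorem coeff_three_swap_left (w : DForm M 3) (i j k : Fin 4) (x : M) :
    ϑ.coeff w ![i, j, k] x = -ϑ.coeff w ![j, i, k] x := by
  rw [← ϑ.coeff_comp_swap w ![j, i, k] x (i := 0) (j := 1) (by decide)]
  congr 1
  funext l
  fin_cases l <;> rfl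

theorem coeff_three_swap_right (w : DForm M 3) (i j k : Fin 4) (x : M) :
    ϑ.coeff w ![i, j, k] x = -ϑ.coeff w ![i, k, j] x := by
  rw [← ϑ.coeff_comp_swap w ![i, k, j] x (i := 1) (j := 2) (by decide)]
  congr 1
  funext l
  fin_cases l <;> rfl

theorem coeff_oneForm (a b : Fin 4) (x : M) :
    ϑ.coeff (oneForm (ϑ.form a)) ![b] x = if a = b then 1 else 0 :=
  ϑ.form_frame b a x

theorem coeff_dForm_oneForm (a b c : Fin 4) (x : M) :
    ϑ.coeff (dForm (oneForm (ϑ.form a))) ![b, c] x = ϑ.C a b c x := by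
  refine congrArg (dForm (oneForm (ϑ.form a)) x) ?_
  funext l
  fin_cases l <;> rfl

theorem C_swap (a b c : Fin 4) (x : M) : ϑ.C a b c x = -ϑ.C a c b x := by
  rw [← coeff_dForm_oneForm, ← coeff_dForm_oneForm, coeff_two_swap]

theorem C_self (a b : Fin 4) (x : M) : ϑ.C a b b x = 0 := by
  linarith [ϑ.C_swap a b b x]

theorem B_swap (a b c p : Fin 4) (x : M) : ϑ.B a b c p x = -ϑ.B a c b p x := by
  have h : ϑ.C a b c = -ϑ.C a c b := by
    funext y
    exact ϑ.C_swap a b c y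
  unfold B
  rw [h, mvfderiv_neg]
  rfl

theorem B_self (a b p : Fin 4) (x : M) : ϑ.B a b b p x = 0 := by
  linarith [ϑ.B_swap a b b p x]

theorem eq_sum_form_smul_frame (x : M) (v : E4) :
    v = ∑ k, (ϑ.form k x : E4 →L[ℝ] ℝ) v • (ϑ.frame k x : E4) := by
  apply (ϑ.components_bijective x).1
  funext a
  change (ϑ.form a x : E4 →L[ℝ] ℝ) v = (ϑ.form a x : E4 →L[ℝ] ℝ) _
  rw [map_sum]
  have h : ∀ k, (ϑ.form a x : E4 →L[ℝ] ℝ) (ϑ.frame k x : E4) = if a = k then 1 else 0 :=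
    fun k => ϑ.form_frame k a x
  simp [h]

theorem oneForm_ext {α β : DForm M 1} {x : M} (h : ∀ b, ϑ.coeff α ![b] x = ϑ.coeff β ![b] x) :
    α x = β x := by
  obtain ⟨L, hL⟩ := covectorEquiv.surjective (α x)
  obtain ⟨N, hN⟩ := covectorEquiv.surjective (β x)
  suffices L = N by rw [← hL, ← hN, this]
  have h1 : ∀ b, L (ϑ.frame b x) = N (ϑ.frame b x) := by
    intro b
    have h2 := h b
    unfold coeff at h2
    rw [← hL, ← hN] at h2
    exact h2
  have h2 : ∀ (e : Fin 4 → E4) (r : Fin 4 → ℝ), (∀ b, L (e b) = N (e b)) →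
      L (∑ k, r k • e k) = N (∑ k, r k • e k) := by
    intro e r he
    simp [he]
  ext1 v
  have hv := ϑ.eq_sum_form_smul_frame x v
  exact (congrArg L hv).trans ((h2 _ _ h1).trans (congrArg N hv).symm)

theorem coeff_hodge_two (w : DForm M 2) (m n : Fin 4) (x : M) :
    ϑ.coeff (ϑ.hodge (p := 2) (q := 2) (by norm_num) w) ![m, n] x =
      starTable (fun i j => ϑ.coeff w ![i, j] x) m n := by
  rw [← sum_leviCivita_eq_starTable fun i j => ϑ.coeff_two_swap w i j x]
  refine (ϑ.hodge_frame (p := 2) (q := 2) (by norm_num) w x ![m, n]).trans ?_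
  rw [sum_univ_fun_succ]
  congr 1
  refine Finset.sum_congr rfl fun i _ => ?_
  rw [sum_univ_fun_succ]
  refine Finset.sum_congr rfl fun j _ => ?_
  rw [Fintype.sum_unique, Fin.prod_univ_two]
  congr 2
  funext l
  fin_cases l <;> rfl

theorem coeff_hodge_three (w : DForm M 3) (b : Fin 4) (x : M) :
    ϑ.coeff (ϑ.hodge (p := 3) (q := 1) (by norm_num) w) ![b] x =
      ![ϑ.coeff w ![1, 2, 3] x, ϑ.coeff w ![0, 2, 3] x, -ϑ.coeff w ![0, 1, 3] x,
        ϑ.coeff w ![0, 1, 2] x] b := by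
  rw [← sum_leviCivita_three (F := fun i j k => ϑ.coeff w ![i, j, k] x)
    (fun i j k => ϑ.coeff_three_swap_left w i j k x)
    (fun i j k => ϑ.coeff_three_swap_right w i j k x)]
  refine (ϑ.hodge_frame (p := 3) (q := 1) (by norm_num) w x ![b]).trans ?_
  rw [sum_univ_fun_succ]
  have h6 : ((Nat.factorial 3 : ℕ) : ℝ) = 6 := by norm_num [Nat.factorial]
  rw [h6]
  congr 1
  refine Finset.sum_congr rfl fun i _ => ?_
  rw [sum_univ_fun_succ]
  refine Finset.sum_congr rfl fun j _ => ?_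
  rw [sum_univ_fun_succ]
  refine Finset.sum_congr rfl fun k _ => ?_
  rw [Fintype.sum_unique, Fin.prod_univ_three]
  congr 2
  funext l
  fin_cases l <;> rfl

theorem coeff_hodge_oneForm (a i j k : Fin 4) (x : M) :
    ϑ.coeff (ϑ.hodge (p := 1) (q := 3) (by norm_num) (oneForm (ϑ.form a))) ![i, j, k] x =
      sgn a * leviCivita ![a, i, j, k] := by
  refine (ϑ.hodge_frame (p := 1) (q := 3) (by norm_num) (oneForm (ϑ.form a)) x ![i, j, k]).trans ?_
  rw [sum_univ_fun_succ]
  have h1 : ((Nat.factorial 1 : ℕ) : ℝ) = 1 := by norm_num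
  rw [h1, inv_one, one_mul, Finset.sum_eq_single a]
  · rw [Fintype.sum_unique, Fin.prod_univ_one]
    have h2 : ϑ.coeff (oneForm (ϑ.form a)) (Matrix.vecCons a default) x = 1 :=
      (ϑ.form_frame a a x).trans (by simp)
    change sgn a * ϑ.coeff (oneForm (ϑ.form a)) (Matrix.vecCons a default) x * _ = _
    rw [h2, mul_one]
    congr 2
    funext l
    fin_cases l <;> rfl
  · intro m _ hm
    rw [Fintype.sum_unique]
    have h2 : ϑ.coeff (oneForm (ϑ.form a)) (Matrix.vecCons m default) x = 0 :=
      (ϑ.form_frame m a x).trans (by simp [hm.symm])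
    change _ * ϑ.coeff (oneForm (ϑ.form a)) (Matrix.vecCons m default) x * _ = _
    rw [h2, mul_zero, zero_mul]
  · simp

/-- Each component of a 4-form is ε times the top one, so the contraction is a sum of ε², which is
4!. Raising all indices supplies the factor det η = -1. -/
theorem coeff_hodge_four (w : DForm M 4) (x : M) (c : Fin 0 → Fin 4) :
    ϑ.coeff (ϑ.hodge (p := 4) (q := 0) (by norm_num) w) c x = -ϑ.coeff w ![0, 1, 2, 3] x := by
  refine (ϑ.hodge_frame _ w x c).trans ?_
  have h1 : ∀ b : Fin 4 → Fin 4, (w x fun i => ϑ.frame (b i) x) =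
      leviCivita b * ϑ.coeff w ![0, 1, 2, 3] x := by
    intro b
    refine (alternating_comp_eq_leviCivita (w x).toAlternatingMap (fun i => ϑ.frame i x) b).trans ?_
    congr 1
    refine congrArg (w x) ?_
    funext l
    fin_cases l <;> rfl
  have h2 : ∀ b : Fin 4 → Fin 4,
      (fun i => Fin.append b c (Fin.cast (by norm_num : 4 = 4 + 0) i)) = b := by
    intro b
    funext l
    fin_cases l <;> rfl
  have h3 : ∀ b : Fin 4 → Fin 4, (∏ i, sgn (b i)) * (w x fun i => ϑ.frame (b i) x) *
      leviCivita (fun i => Fin.append b c (Fin.cast (by norm_num : 4 = 4 + 0) i)) =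
      leviCivita b * leviCivita b * (-ϑ.coeff w ![0, 1, 2, 3] x) := by
    intro b
    rw [h1, h2, ← mul_assoc, prod_sgn_mul_leviCivita]
    ring
  rw [Finset.sum_congr rfl fun b _ => h3 b, ← Finset.sum_mul, sum_leviCivita_sq]
  have h24 : ((Nat.factorial 4 : ℕ) : ℝ) = 24 := by norm_num [Nat.factorial]
  rw [h24]
  ring

variable {φ : OpenPartialHomeomorph M E4} [IsManifold (𝓡 4) ∞ M]

theorem coeff_dForm_two (w : DForm M 2) (hφ : φ ∈ IsManifold.maximalAtlas (𝓡 4) ∞ M)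
    {x : M} (hx : x ∈ φ.source) (hw : DifferentiableAt ℝ (pullChart φ w) (φ x)) (i j k : Fin 4) :
    ϑ.coeff (dForm w) ![i, j, k] x =
      fderiv ℝ (fun z => ϑ.coeff w ![j, k] (φ.symm z)) (φ x) (ϑ.vec φ i (φ x)) -
      fderiv ℝ (fun z => ϑ.coeff w ![i, k] (φ.symm z)) (φ x) (ϑ.vec φ j (φ x)) +
      fderiv ℝ (fun z => ϑ.coeff w ![i, j] (φ.symm z)) (φ x) (ϑ.vec φ k (φ x)) +
      ∑ t, (ϑ.C t i j x * ϑ.coeff w ![t, k] x - ϑ.C t i k x * ϑ.coeff w ![t, j] x +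
        ϑ.C t j k x * ϑ.coeff w ![t, i] x) := by
  refine (ϑ.dForm_frame_eq w hφ hx hw ![i, j, k]).trans ?_
  have r0 : Fin.removeNth (α := fun _ => Fin 4) (0 : Fin 3) ![i, j, k] = ![j, k] := by
    funext l; fin_cases l <;> rfl
  have r1 : Fin.removeNth (α := fun _ => Fin 4) (1 : Fin 3) ![i, j, k] = ![i, k] := by
    funext l; fin_cases l <;> rfl
  have r2 : Fin.removeNth (α := fun _ => Fin 4) (2 : Fin 3) ![i, j, k] = ![i, j] := by
    funext l; fin_cases l <;> rfl
  have s0 : Finset.Ici (0 : Fin 2) = {0, 1} := by decide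
  have s1 : Finset.Ici (1 : Fin 2) = {1} := by decide
  have q : ∀ (u v : Fin 4) (l : Fin 2), Fin.removeNth (α := fun _ => Fin 4) l ![u, v] =
      ![![v, u] l] := by
    intro u v l
    funext m; fin_cases l <;> fin_cases m <;> rfl
  have e : ∀ t u : Fin 4, Fin.cons (α := fun _ => Fin 4) t ![u] = ![t, u] := fun t u => rfl
  rw [Fin.sum_univ_three, Fin.sum_univ_two, s0, s1, Finset.sum_pair (by decide),
    Finset.sum_singleton]
  have c0 : (0 : Fin 2).castSucc = 0 := rfl
  have c1 : (1 : Fin 2).castSucc = 1 := rfl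
  simp only [c0, c1, r0, r1, r2, q, e]
  simp only [Finset.sum_add_distrib, Finset.sum_sub_distrib]
  simp [coeff]
  ring

theorem coeff_dForm_three (w : DForm M 3) (hφ : φ ∈ IsManifold.maximalAtlas (𝓡 4) ∞ M)
    {x : M} (hx : x ∈ φ.source) (hw : DifferentiableAt ℝ (pullChart φ w) (φ x))
    (i j k l : Fin 4) :
    ϑ.coeff (dForm w) ![i, j, k, l] x =
      fderiv ℝ (fun z => ϑ.coeff w ![j, k, l] (φ.symm z)) (φ x) (ϑ.vec φ i (φ x)) -
      fderiv ℝ (fun z => ϑ.coeff w ![i, k, l] (φ.symm z)) (φ x) (ϑ.vec φ j (φ x)) +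
      fderiv ℝ (fun z => ϑ.coeff w ![i, j, l] (φ.symm z)) (φ x) (ϑ.vec φ k (φ x)) -
      fderiv ℝ (fun z => ϑ.coeff w ![i, j, k] (φ.symm z)) (φ x) (ϑ.vec φ l (φ x)) +
      ∑ t, (ϑ.C t i j x * ϑ.coeff w ![t, k, l] x - ϑ.C t i k x * ϑ.coeff w ![t, j, l] x +
        ϑ.C t i l x * ϑ.coeff w ![t, j, k] x + ϑ.C t j k x * ϑ.coeff w ![t, i, l] x -
        ϑ.C t j l x * ϑ.coeff w ![t, i, k] x + ϑ.C t k l x * ϑ.coeff w ![t, i, j] x) := by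
  refine (ϑ.dForm_frame_eq w hφ hx hw ![i, j, k, l]).trans ?_
  have r0 : Fin.removeNth (α := fun _ => Fin 4) (0 : Fin 4) ![i, j, k, l] = ![j, k, l] := by
    funext l; fin_cases l <;> rfl
  have r1 : Fin.removeNth (α := fun _ => Fin 4) (1 : Fin 4) ![i, j, k, l] = ![i, k, l] := by
    funext l; fin_cases l <;> rfl
  have r2 : Fin.removeNth (α := fun _ => Fin 4) (2 : Fin 4) ![i, j, k, l] = ![i, j, l] := by
    funext l; fin_cases l <;> rfl
  have r3 : Fin.removeNth (α := fun _ => Fin 4) (3 : Fin 4) ![i, j, k, l] = ![i, j, k] := by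
    funext l; fin_cases l <;> rfl
  have s0 : Finset.Ici (0 : Fin 3) = {0, 1, 2} := by decide
  have s1 : Finset.Ici (1 : Fin 3) = {1, 2} := by decide
  have s2 : Finset.Ici (2 : Fin 3) = {2} := by decide
  have q0 : ∀ u v m : Fin 4, Fin.removeNth (α := fun _ => Fin 4) (0 : Fin 3) ![u, v, m] =
      ![v, m] := by
    intro u v m
    funext m; fin_cases m <;> rfl
  have q1 : ∀ u v m : Fin 4, Fin.removeNth (α := fun _ => Fin 4) (1 : Fin 3) ![u, v, m] =
      ![u, m] := by
    intro u v m
    funext m; fin_cases m <;> rfl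
  have q2 : ∀ u v m : Fin 4, Fin.removeNth (α := fun _ => Fin 4) (2 : Fin 3) ![u, v, m] =
      ![u, v] := by
    intro u v m
    funext m; fin_cases m <;> rfl
  have e : ∀ t u v : Fin 4, Fin.cons (α := fun _ => Fin 4) t ![u, v] = ![t, u, v] :=
    fun t u v => rfl
  rw [Fin.sum_univ_four, Fin.sum_univ_three, s0, s1, s2, Finset.sum_insert (by decide),
    Finset.sum_pair (by decide), Finset.sum_pair (by decide), Finset.sum_singleton]
  have c0 : (0 : Fin 3).castSucc = 0 := rfl
  have c1 : (1 : Fin 3).castSucc = 1 := rfl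
  have c2 : (2 : Fin 3).castSucc = 2 := rfl
  simp only [c0, c1, c2, r0, r1, r2, r3, q0, q1, q2, e]
  simp only [Finset.sum_add_distrib, Finset.sum_sub_distrib]
  simp [coeff]
  ring

end Coframe

/-! ### The Hodge–de Rham Laplacian of the coframe -/

namespace Coframe

variable {M : Type*} [TopologicalSpace M] [ChartedSpace E4 M] (ϑ : Coframe M)

theorem coeff_codiff {p q : ℕ} (h : 4 = p + 1 + q) (α : DForm M (p + 1)) (c : Fin p → Fin 4)
    (x : M) : ϑ.coeff (ϑ.codiff h α) c x =
      -ϑ.coeff (ϑ.hodge (p := q + 1) (q := p) (by omega) (dForm (ϑ.hodge h α))) c x :=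
  ContinuousAlternatingMap.neg_apply _ _

theorem coeff_add {p : ℕ} (α β : DForm M p) (c : Fin p → Fin 4) (x : M) :
    ϑ.coeff (fun y => α y + β y) c x = ϑ.coeff α c x + ϑ.coeff β c x :=
  ContinuousAlternatingMap.add_apply _ _ _

theorem coeff_box (α : DForm M 1) (c : Fin 1 → Fin 4) (x : M) :
    ϑ.coeff (ϑ.box α) c x =
      ϑ.coeff (ϑ.codiff (p := 1) (q := 2) (by norm_num) (dForm α)) c x +
        ϑ.coeff (dForm (ϑ.codiff (p := 0) (q := 3) (by norm_num) α)) c x := by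
  unfold box
  exact ϑ.coeff_add _ _ c x

theorem coeff_hodge_dForm_oneForm (a m n : Fin 4) (x : M) :
    ϑ.coeff (ϑ.hodge (p := 2) (q := 2) (by norm_num) (dForm (oneForm (ϑ.form a)))) ![m, n] x =
      starTable (fun i j => ϑ.C a i j x) m n := by
  rw [coeff_hodge_two]
  simp only [coeff_dForm_oneForm]

theorem pullChart_zeroForm {φ : OpenPartialHomeomorph M E4} {w : DForm M 0} {g : M → ℝ}
    (h : ∀ z, ϑ.coeff w Fin.elim0 z = g z) : pullChart φ w =
      fun y => ContinuousAlternatingMap.constOfIsEmpty ℝ E4 (Fin 0) (g (φ.symm y)) := by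
  funext y
  ext v
  refine Eq.trans ?_ (h (φ.symm y))
  refine congrArg (w (φ.symm y)) ?_
  funext l
  exact l.elim0

variable [IsManifold (𝓡 4) ∞ M] {φ : OpenPartialHomeomorph M E4}

/-- Every entry of the table is 0, an entry of C or its negative, so the derivative acts entry by
entry and turns C into B. -/
theorem fderiv_starTable_C (hφ : φ ∈ IsManifold.maximalAtlas (𝓡 4) ∞ M) {x : M}
    (hx : x ∈ φ.source) (a m n p : Fin 4) :
    fderiv ℝ (fun z => starTable (fun i j => ϑ.C a i j (φ.symm z)) m n) (φ x)
      (ϑ.vec φ p (φ x)) = starTable (fun i j => ϑ.B a i j p x) m n := by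
  have hn : ∀ i j, fderiv ℝ (fun z => -ϑ.C a i j (φ.symm z)) (φ x) (ϑ.vec φ p (φ x)) =
      -ϑ.B a i j p x := by
    intro i j
    rw [fderiv_fun_neg, ← ϑ.fderiv_C_symm hφ hx]
    rfl
  have h0 : fderiv ℝ (fun _ : E4 => (0 : ℝ)) (φ x) (ϑ.vec φ p (φ x)) = 0 := by simp
  fin_cases m <;> fin_cases n <;>
    first
    | exact h0
    | exact hn _ _
    | exact ϑ.fderiv_C_symm hφ hx _ _ _ _

theorem differentiableAt_pullChart_hodge_dForm
    (hφ : φ ∈ IsManifold.maximalAtlas (𝓡 4) ∞ M) {y : E4} (hy : y ∈ φ.target) (a : Fin 4) :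
    DifferentiableAt ℝ (pullChart φ (ϑ.hodge (p := 2) (q := 2) (by norm_num)
      (dForm (oneForm (ϑ.form a))))) y := by
  refine ϑ.differentiableAt_pullChart_hodge _ _ hφ hy fun c => ?_
  have hc : c = ![c 0, c 1] := by
    funext l
    fin_cases l <;> rfl
  rw [hc]
  refine (ϑ.differentiableAt_C_symm hφ hy a (c 0) (c 1)).congr_of_eventuallyEq ?_
  exact Eventually.of_forall fun z => ϑ.coeff_dForm_oneForm a (c 0) (c 1) (φ.symm z)

theorem coeff_dForm_hodge_dForm (a i j k : Fin 4) (x : M) :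
    ϑ.coeff (dForm (ϑ.hodge (p := 2) (q := 2) (by norm_num)
      (dForm (oneForm (ϑ.form a))))) ![i, j, k] x =
      starTable (fun m n => ϑ.B a m n i x) j k - starTable (fun m n => ϑ.B a m n j x) i k +
      starTable (fun m n => ϑ.B a m n k x) i j +
      ∑ t, (ϑ.C t i j x * starTable (fun m n => ϑ.C a m n x) t k -
        ϑ.C t i k x * starTable (fun m n => ϑ.C a m n x) t j +
        ϑ.C t j k x * starTable (fun m n => ϑ.C a m n x) t i) := by
  have hφ : chartAt E4 x ∈ IsManifold.maximalAtlas (𝓡 4) ∞ M := IsManifold.chart_mem_maximalAtlas x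
  have hx := mem_chart_source E4 x
  rw [ϑ.coeff_dForm_two _ hφ hx
    (ϑ.differentiableAt_pullChart_hodge_dForm hφ (mem_chart_target E4 x) a)]
  simp only [coeff_hodge_dForm_oneForm, ϑ.fderiv_starTable_C hφ hx]

/-- `d† d ϑᵃ`. -/
theorem coeff_codiff_dForm (a b : Fin 4) (x : M) :
    ϑ.coeff (ϑ.codiff (p := 1) (q := 2) (by norm_num) (dForm (oneForm (ϑ.form a)))) ![b] x =
      -(sgn a * ϑ.B1 x a b + ∑ n, ϑ.C a b n x * (sgn n * ϑ.Ctr n x) +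
        1 / 2 * ∑ m, ∑ n, ϑ.C a m n x * (sgn m * sgn n * ϑ.Clow b m n x)) := by
  have h1 : ϑ.coeff (ϑ.codiff (p := 1) (q := 2) (by norm_num) (dForm (oneForm (ϑ.form a))))
      ![b] x = -ϑ.coeff (ϑ.hodge (p := 3) (q := 1) (by norm_num)
        (dForm (ϑ.hodge (p := 2) (q := 2) (by norm_num) (dForm (oneForm (ϑ.form a)))))) ![b] x :=
    ϑ.coeff_codiff (p := 1) (q := 2) (by norm_num) (dForm (oneForm (ϑ.form a))) ![b] x
  have hs : sgn a * sgn a = 1 := by unfold sgn; split_ifs <;> norm_num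
  have hB : sgn a * ϑ.B1 x a b = ∑ m, sgn m * ϑ.B a b m m x := by
    unfold B1
    rw [Finset.mul_sum]
    refine Finset.sum_congr rfl fun m _ => ?_
    linear_combination (sgn m * ϑ.B a b m m x) * hs
  rw [h1, coeff_hodge_three]
  simp only [coeff_dForm_hodge_dForm]
  rw [hB]
  -- Antisymmetry with literal indices sends each component to one with increasing indices. For each
  -- b both sides are then polynomials in the remaining components; the identity ddϑ = 0 is not
  -- needed.
  have b1 := fun p => ϑ.B_swap a 1 0 p x
  have b2 := fun p => ϑ.B_swap a 2 0 p x
  have b3 := fun p => ϑ.B_swap a 3 0 p x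
  have b4 := fun p => ϑ.B_swap a 2 1 p x
  have b5 := fun p => ϑ.B_swap a 3 1 p x
  have b6 := fun p => ϑ.B_swap a 3 2 p x
  have b7 := fun m p => ϑ.B_self a m p x
  have c1 := fun t => ϑ.C_swap t 1 0 x
  have c2 := fun t => ϑ.C_swap t 2 0 x
  have c3 := fun t => ϑ.C_swap t 3 0 x
  have c4 := fun t => ϑ.C_swap t 2 1 x
  have c5 := fun t => ϑ.C_swap t 3 1 x
  have c6 := fun t => ϑ.C_swap t 3 2 x
  have c7 := fun t m => ϑ.C_self t m x
  unfold Ctr Clow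
  fin_cases b <;>
    simp [Fin.sum_univ_four, starTable, sgn, b1, b2, b3, b4, b5, b6, b7,
      c1, c2, c3, c4, c5, c6, c7] <;> ring

/-- The components of *ϑᵃ are constants ±ε, so only the C terms of the formula for d survive, and
they assemble to the trace of C. -/
theorem coeff_codiff_oneForm (a : Fin 4) (x : M) (c : Fin 0 → Fin 4) :
    ϑ.coeff (ϑ.codiff (p := 0) (q := 3) (by norm_num) (oneForm (ϑ.form a))) c x =
      sgn a * ϑ.Ctr a x := by
  have h1 : ϑ.coeff (ϑ.codiff (p := 0) (q := 3) (by norm_num) (oneForm (ϑ.form a))) c x =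
      -ϑ.coeff (ϑ.hodge (p := 4) (q := 0) (by norm_num)
        (dForm (ϑ.hodge (p := 1) (q := 3) (by norm_num) (oneForm (ϑ.form a))))) c x :=
    ϑ.coeff_codiff (p := 0) (q := 3) (by norm_num) (oneForm (ϑ.form a)) c x
  have hφ : chartAt E4 x ∈ IsManifold.maximalAtlas (𝓡 4) ∞ M := IsManifold.chart_mem_maximalAtlas x
  have hx := mem_chart_source E4 x
  have hy := mem_chart_target E4 x
  have hd : DifferentiableAt ℝ (pullChart (chartAt E4 x)
      (ϑ.hodge (p := 1) (q := 3) (by norm_num) (oneForm (ϑ.form a)))) (chartAt E4 x x) := by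
    refine ϑ.differentiableAt_pullChart_hodge _ _ hφ hy fun c => ?_
    have hc : c = ![c 0] := by
      funext l
      fin_cases l; rfl
    rw [hc]
    refine (differentiableAt_const (if a = c 0 then (1 : ℝ) else 0)).congr_of_eventuallyEq ?_
    exact Eventually.of_forall fun z => ϑ.coeff_oneForm a (c 0) _
  rw [h1, coeff_hodge_four, neg_neg, ϑ.coeff_dForm_three _ hφ hx hd]
  simp only [coeff_hodge_oneForm, fderiv_fun_const]
  have c1 := fun t => ϑ.C_swap t 1 0 x
  have c2 := fun t => ϑ.C_swap t 2 0 x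
  have c3 := fun t => ϑ.C_swap t 3 0 x
  have c4 := fun t => ϑ.C_swap t 2 1 x
  have c5 := fun t => ϑ.C_swap t 3 1 x
  have c6 := fun t => ϑ.C_swap t 3 2 x
  have c7 := fun t m => ϑ.C_self t m x
  unfold Ctr
  fin_cases a <;>
    simp [Fin.sum_univ_four, leviCivita_vec, sgn,
      c1, c2, c3, c4, c5, c6, c7] <;> ring

/-- `d d† ϑᵃ`. -/
theorem coeff_dForm_codiff (a b : Fin 4) (x : M) :
    ϑ.coeff (dForm (ϑ.codiff (p := 0) (q := 3) (by norm_num) (oneForm (ϑ.form a)))) ![b] x =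
      -(sgn a * ϑ.B2 x a b) := by
  set φ := chartAt E4 x with hφdef
  have hφ : φ ∈ IsManifold.maximalAtlas (𝓡 4) ∞ M := IsManifold.chart_mem_maximalAtlas x
  have hx : x ∈ φ.source := mem_chart_source E4 x
  have hy := φ.map_source hx
  have hp : pullChart φ (ϑ.codiff (p := 0) (q := 3) (by norm_num) (oneForm (ϑ.form a))) =
      fun y => ContinuousAlternatingMap.constOfIsEmpty ℝ E4 (Fin 0)
        (sgn a * ϑ.Ctr a (φ.symm y)) :=
    ϑ.pullChart_zeroForm fun z => ϑ.coeff_codiff_oneForm a z Fin.elim0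
  have hg : HasFDerivAt (fun y => sgn a * ϑ.Ctr a (φ.symm y))
      (sgn a • ∑ m, fderiv ℝ (fun z => ϑ.C m a m (φ.symm z)) (φ x)) (φ x) := by
    unfold Ctr
    exact (HasFDerivAt.fun_sum fun m _ =>
      (ϑ.differentiableAt_C_symm hφ hy m a m).hasFDerivAt).const_mul _
  have hd : DifferentiableAt ℝ (pullChart φ
      (ϑ.codiff (p := 0) (q := 3) (by norm_num) (oneForm (ϑ.form a)))) (φ x) := by
    rw [hp]
    exact (ContinuousAlternatingMap.constOfIsEmptyLIE ℝ E4 ℝ (Fin 0)).differentiableAt.comp (φ x)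
      hg.differentiableAt
  have h := ϑ.dForm_frame _ hφ hy hd ![b]
  rw [φ.left_inv hx] at h
  refine h.trans ?_
  rw [hp, extDeriv_constOfIsEmpty, hg.fderiv]
  change (sgn a • ∑ m, fderiv ℝ (fun z => ϑ.C m a m (φ.symm z)) (φ x)) (ϑ.vec φ b (φ x)) = _
  simp only [smul_apply, sum_apply,
    ϑ.fderiv_C_symm hφ hx, smul_eq_mul]
  unfold B2
  rw [← mul_neg, ← Finset.sum_neg_distrib]
  congr 1
  exact Finset.sum_congr rfl fun m _ => ϑ.B_swap m a m b x

theorem coeff_boxForm (a b : Fin 4) (x : M) :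
    ϑ.coeff (ϑ.boxForm a) ![b] x =
      -(sgn a * ϑ.B1 x a b + sgn a * ϑ.B2 x a b + ∑ n, ϑ.C a b n x * (sgn n * ϑ.Ctr n x) +
        1 / 2 * ∑ m, ∑ n, ϑ.C a m n x * (sgn m * sgn n * ϑ.Clow b m n x)) := by
  have h : ϑ.coeff (ϑ.boxForm a) ![b] x =
    ϑ.coeff (ϑ.codiff (p := 1) (q := 2) (by norm_num) (dForm (oneForm (ϑ.form a)))) ![b] x +
    ϑ.coeff (dForm (ϑ.codiff (p := 0) (q := 3) (by norm_num) (oneForm (ϑ.form a)))) ![b] x :=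
    ϑ.coeff_box (oneForm (ϑ.form a)) ![b] x
  rw [h, coeff_codiff_dForm, coeff_dForm_codiff]
  ring

theorem boxMatrix_eq (a b : Fin 4) (x : M) :
    ϑ.boxMatrix x a b =
      -(sgn a * ϑ.B1 x a b + sgn a * ϑ.B2 x a b + ∑ n, ϑ.C a b n x * (sgn n * ϑ.Ctr n x) +
        1 / 2 * ∑ m, ∑ n, ϑ.C a m n x * (sgn m * sgn n * ϑ.Clow b m n x)) := by
  rw [← coeff_boxForm]
  refine congrArg (ϑ.boxForm a x) ?_
  funext l
  fin_cases l; rfl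

theorem boxForm_eq (a : Fin 4) (x : M) : ϑ.boxForm a x =
    -(∑ b, (sgn a * ϑ.B1 x a b + sgn a * ϑ.B2 x a b +
        ∑ n, ϑ.C a b n x * (sgn n * ϑ.Ctr n x) +
        1 / 2 * ∑ m, ∑ n, ϑ.C a m n x * (sgn m * sgn n * ϑ.Clow b m n x)) •
      oneForm (ϑ.form b) x) := by
  refine ϑ.oneForm_ext (β := fun x => -(∑ b, (sgn a * ϑ.B1 x a b + sgn a * ϑ.B2 x a b +
        ∑ n, ϑ.C a b n x * (sgn n * ϑ.Ctr n x) +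
        1 / 2 * ∑ m, ∑ n, ϑ.C a m n x * (sgn m * sgn n * ϑ.Clow b m n x)) •
      oneForm (ϑ.form b) x)) fun d => ?_
  rw [coeff_boxForm]
  have hlin : ∀ r : Fin 4 → ℝ, (-(∑ b, r b • oneForm (ϑ.form b) x))
      (fun i => ϑ.frame (![d] i) x) = -r d := by
    intro r
    refine (ContinuousAlternatingMap.neg_apply _ _).trans ?_
    congr 1
    refine (ContinuousAlternatingMap.sum_apply _ _).trans ?_
    have h : ∀ b, (r b • oneForm (ϑ.form b) x) (fun i => ϑ.frame (![d] i) x) =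
        r b * if b = d then 1 else 0 := by
      intro b
      refine (ContinuousAlternatingMap.smul_apply _ _ _).trans ?_
      rw [smul_eq_mul]
      congr 1
      exact ϑ.coeff_oneForm b d x
    refine (Finset.sum_congr rfl fun b _ => h b).trans ?_
    simp
  exact (hlin fun b => sgn a * ϑ.B1 x a b + sgn a * ϑ.B2 x a b +
    ∑ n, ϑ.C a b n x * (sgn n * ϑ.Ctr n x) +
    1 / 2 * ∑ m, ∑ n, ϑ.C a m n x * (sgn m * sgn n * ϑ.Clow b m n x)).symm

end Coframe

/-! ### The wave-type equation inside the quasi-linear class -/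

theorem sgn_mul_sgn (a : Fin 4) : sgn a * sgn a = 1 := by
  unfold sgn
  split_ifs <;> norm_num

theorem harmonicConditions_waveParams : waveParams.HarmonicConditions := by
  unfold Params.HarmonicConditions waveParams
  norm_num

namespace Coframe

variable {M : Type*} [TopologicalSpace M] [ChartedSpace E4 M] (ϑ : Coframe M)

theorem tr_B2 (x : M) : tr (ϑ.B2 x) = tr (ϑ.B1 x) := by
  unfold tr B1 B2
  simp only [Finset.mul_sum]
  rw [Finset.sum_comm]
  refine Finset.sum_congr rfl fun a _ => Finset.sum_congr rfl fun m _ => ?_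
  linear_combination (-sgn m * ϑ.B a a m m x) * sgn_mul_sgn a

theorem A1_eq (x : M) (a b : Fin 4) :
    ϑ.A1 x a b = sgn a * ∑ n, ϑ.C a b n x * (sgn n * ϑ.Ctr n x) := by
  unfold A1 Clow
  rw [Finset.mul_sum]
  exact Finset.sum_congr rfl fun n _ => by ring

theorem A3_eq (x : M) (a b : Fin 4) :
    ϑ.A3 x a b = sgn a * ∑ m, ∑ n, ϑ.C a m n x * (sgn m * sgn n * ϑ.Clow b m n x) := by
  unfold A3
  simp only [Finset.mul_sum]
  refine Finset.sum_congr rfl fun m _ => Finset.sum_congr rfl fun n _ => ?_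
  rw [Clow]
  ring

theorem coeff_smul_oneForm (r : ℝ) (a b : Fin 4) (x : M) :
    ϑ.coeff (fun y => r • oneForm (ϑ.form a) y) ![b] x = r * if a = b then 1 else 0 := by
  refine (ContinuousAlternatingMap.smul_apply _ _ _).trans ?_
  rw [smul_eq_mul]
  congr 1
  exact ϑ.coeff_oneForm a b x

variable [IsManifold (𝓡 4) ∞ M]

theorem sgn_mul_boxMatrix (x : M) (a b : Fin 4) : sgn a * ϑ.boxMatrix x a b =
    -(ϑ.B1 x a b + ϑ.B2 x a b + ϑ.A1 x a b + 1 / 2 * ϑ.A3 x a b) := by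
  rw [boxMatrix_eq, A1_eq, A3_eq]
  linear_combination (-ϑ.B1 x a b - ϑ.B2 x a b) * sgn_mul_sgn a

theorem sum_boxMatrix (x : M) : ∑ m, ϑ.boxMatrix x m m =
    -(2 * tr (ϑ.B1 x) + tr (ϑ.A1 x) + 1 / 2 * tr (ϑ.A3 x)) := by
  have h : ∀ m, ϑ.boxMatrix x m m =
      -(sgn m * ϑ.B1 x m m + sgn m * ϑ.B2 x m m + sgn m * ϑ.A1 x m m +
        1 / 2 * (sgn m * ϑ.A3 x m m)) := by
    intro m
    linear_combination sgn m * ϑ.sgn_mul_boxMatrix x m m - ϑ.boxMatrix x m m * sgn_mul_sgn m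
  rw [Finset.sum_congr rfl fun m _ => h m, Finset.sum_neg_distrib]
  simp only [Finset.sum_add_distrib, ← Finset.mul_sum]
  have h2 := ϑ.tr_B2 x
  unfold tr at h2 ⊢
  linarith

/-- Equal weights on symmetric and antisymmetric parts restore the full matrices. In the trace term,
β₄ = -1/2 is -1/4 taken twice, because ⁽¹⁾B and ⁽²⁾B have the same trace. -/
theorem leading_add_quadratic_waveParams (x : M) (a b : Fin 4) :
    ϑ.leading waveParams x a b + ϑ.quadratic waveParams x a b =
      -(sgn a * ϑ.boxMatrix x a b - 1 / 4 * (eta a b * ∑ m, ϑ.boxMatrix x m m)) := by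
  rw [sgn_mul_boxMatrix, sum_boxMatrix]
  unfold leading quadratic waveParams symPart antiPart
  ring

theorem coeff_boxForm_eq_boxMatrix (a b : Fin 4) (x : M) :
    ϑ.coeff (ϑ.boxForm a) ![b] x = ϑ.boxMatrix x a b := by
  rw [coeff_boxForm, boxMatrix_eq]

theorem boxForm_eq_smul_iff (a : Fin 4) (x : M) (r : ℝ) :
    ϑ.boxForm a x = r • oneForm (ϑ.form a) x ↔
      ∀ b, ϑ.boxMatrix x a b = r * if a = b then 1 else 0 := by
  constructor
  · intro h b
    rw [← ϑ.coeff_boxForm_eq_boxMatrix, ← ϑ.coeff_smul_oneForm]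
    exact congrArg (fun f : E4 [⋀^Fin 1]→L[ℝ] ℝ => f fun i => ϑ.frame (![b] i) x) h
  · intro h
    refine ϑ.oneForm_ext (β := fun y => r • oneForm (ϑ.form a) y) fun b => ?_
    rw [coeff_boxForm_eq_boxMatrix, coeff_smul_oneForm, h]

theorem waveEqOn_iff (U : Set M) : ϑ.WaveEqOn U ↔ ∀ x ∈ U, ϑ.FieldEq waveParams x := by
  unfold WaveEqOn FieldEq
  simp only [leading_add_quadratic_waveParams, boxForm_eq_smul_iff]
  constructor
  · rintro ⟨lam, h⟩ x hx a b
    have h1 := h x hx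
    simp only [h1, eta]
    by_cases hab : a = b <;> simp [hab]
    ring
  · intro h
    -- Taking the trace of M = λ·1 forces this λ. No regularity of λ is asked, so the argument is
    -- pointwise and U is arbitrary.
    refine ⟨fun x => 1 / 4 * ∑ m, ϑ.boxMatrix x m m, fun x hx a b => ?_⟩
    have h1 := h x hx a b
    by_cases hab : a = b
    · simp only [eta, hab, if_true] at h1 ⊢
      have h2 := sgn_mul_sgn b
      linear_combination (-sgn b) * h1 - (ϑ.boxMatrix x b b -
        1 / 4 * ∑ m, ϑ.boxMatrix x m m) * h2
    · simp only [eta, hab, if_false] at h1 ⊢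
      have h2 := sgn_mul_sgn a
      linear_combination (-sgn a) * h1 - (ϑ.boxMatrix x a b) * h2

end Coframe

/-! ### Pointwise algebra of a quasi-conformal coframe -/

namespace Coframe

variable {M : Type*} [TopologicalSpace M] [ChartedSpace E4 M] (ϑ : Coframe M)

/-- The field equation for the anholonomity of a quasi-conformal coframe. -/
theorem fieldEq_lhs_of_C_eq {p : Params} (hp : p.HarmonicConditions) {x : M}
    {P : Fin 4 → ℝ} {K : Fin 4 → Fin 4 → ℝ} (hP : P 0 = 0) (hK0 : ∀ b, K b 0 = 0)
    (hK : ∀ b c, K b c = K c b)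
    (hC : ∀ a b c, ϑ.C a b c x =
      -sgn a * ((if a = c then 1 else 0) * P b - (if a = b then 1 else 0) * P c))
    (hB : ∀ a b c d, ϑ.B a b c d x = -sgn a * ((if a = c then 1 else 0) * (K b d - P b * P d) -
      (if a = b then 1 else 0) * (K c d - P c * P d))) (a b : Fin 4) :
    ϑ.leading p x a b + ϑ.quadratic p x a b =
      (if a = b then (if a = 0 then p.β₄ - p.β₁ else -(p.β₁ + p.β₄)) else 0) *
        (K 1 1 + K 2 2 + K 3 3) := by
  obtain ⟨h1, h2, h3, h4⟩ := hp
  have hK1 : ∀ b, K 0 b = 0 := fun b => by rw [hK, hK0]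
  set T := K 1 1 + K 2 2 + K 3 3 with hT
  set N := -(P 1 * P 1 + P 2 * P 2 + P 3 * P 3) with hN
  -- Lowering the index absorbs the sign of C and leaves Kronecker deltas. Hence δ_{ab} and η_{ab}
  -- both occur below and must cancel separately.
  have hL : ∀ a b c, ϑ.Clow a b c x =
      (if a = b then 1 else 0) * P c - (if a = c then 1 else 0) * P b := by
    intro a b c
    rw [Clow, hC]
    linear_combination ((if a = b then 1 else 0) * P c - (if a = c then 1 else 0) * P b) *
      sgn_mul_sgn a
  have hCtr : ∀ b, ϑ.Ctr b x = P b := by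
    intro b
    unfold Ctr
    fin_cases b <;> simp [Fin.sum_univ_four, hC, sgn, hP]
  have e1' : ∀ a b, ϑ.B1 x a b =
      (K b a - P a * P b) + (if a = b then 1 else 0) * (-T - N) := by
    intro a b
    unfold B1
    simp only [hB, Fin.sum_univ_four, hT, hN]
    fin_cases a <;> fin_cases b <;> simp [sgn, hP, hK0, hK1] <;> ring
  have e1 : ∀ a b, ϑ.B1 x a b =
      (K a b - P a * P b) + (if a = b then 1 else 0) * (-T - N) := fun a b => by
    rw [e1', hK b a]
  have e2 : ∀ a b, ϑ.B2 x a b = -(K a b - P a * P b) := by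
    intro a b
    unfold B2
    simp only [hB, Fin.sum_univ_four]
    fin_cases a <;> simp [sgn, hP, hK1]
  have e3 : ∀ a b, ϑ.B3 x a b = 0 := by
    intro a b
    unfold B3
    simp only [hB, Fin.sum_univ_four]
    fin_cases a <;> fin_cases b <;> simp [sgn, hP, hK0, hK1, hK 2 1, hK 3 1, hK 3 2] <;> ring
  have f1 : ∀ a b, ϑ.A1 x a b = (if a = b then 1 else 0) * N + P a * P b := by
    intro a b
    unfold A1
    simp only [hL, hCtr, Fin.sum_univ_four, hN]
    fin_cases a <;> fin_cases b <;> simp [sgn, hP] <;> ring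
  have f2 : ∀ a b, ϑ.A2 x a b = 0 := by
    intro a b
    unfold A2
    simp only [hL, hCtr, Fin.sum_univ_four]
    fin_cases a <;> fin_cases b <;> simp [sgn, hP] <;> ring
  have f3 : ∀ a b, ϑ.A3 x a b = 2 * (eta a b * N - P a * P b) := by
    intro a b
    unfold A3
    simp only [hL, Fin.sum_univ_four, hN]
    fin_cases a <;> fin_cases b <;> simp [sgn, hP, eta] <;> ring
  have f4 : ∀ a b, ϑ.A4 x a b = eta a b * N - P a * P b := by
    intro a b
    unfold A4
    simp only [hL, hC, Fin.sum_univ_four, hN]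
    fin_cases a <;> fin_cases b <;> simp [sgn, hP, eta] <;> ring
  have f5 : ∀ a b, ϑ.A5 x a b = 3 * (P a * P b) := by
    intro a b
    unfold A5
    simp only [hL, hC, Fin.sum_univ_four]
    fin_cases a <;> fin_cases b <;> simp [sgn, hP] <;> ring
  have f6 : ∀ a b, ϑ.A6 x a b = eta a b * N + 2 * (P a * P b) := by
    intro a b
    unfold A6
    simp only [hL, hC, Fin.sum_univ_four, hN]
    fin_cases a <;> fin_cases b <;> simp [sgn, hP, eta] <;> ring
  have g1 : tr (ϑ.B1 x) = T + N := by
    simp only [tr, e1, Fin.sum_univ_four, hT, hN]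
    simp [sgn, hP, hK0]
    ring
  have g2 : tr (ϑ.A1 x) = -N := by
    simp only [tr, f1, Fin.sum_univ_four, hN]
    simp [sgn, hP]
    ring
  have g3 : tr (ϑ.A3 x) = 6 * N := by
    simp only [tr, f3, Fin.sum_univ_four, hN]
    simp [sgn, hP, eta]
    ring
  have g4 : tr (ϑ.A4 x) = 3 * N := by
    simp only [tr, f4, Fin.sum_univ_four, hN]
    simp [sgn, hP, eta]
    ring
  -- The conditions are solved for β₂, α₁, α₇ and β₄, so that after substitution only the T terms
  -- survive.
  have h3' : p.α₇ = -(p.β₁ - 2 * p.α₃ - p.α₄ + 3 * p.α₅ + 2 * p.α₆) := by linarith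
  unfold leading quadratic symPart antiPart A7
  simp only [hCtr, e1, e2, e3, f1, f2, f3, f4, f5, f6, g1, g2, g3, g4, hK b a, ← h1, ← h2, h3', h4]
  by_cases hab : a = b
  · subst hab
    by_cases ha : a = 0
    · subst ha
      simp only [eta, sgn, if_true]
      ring
    · simp only [eta, sgn, if_true, ha, if_false]
      ring
  · simp only [eta, hab, Ne.symm hab, if_false]
    ring

end Coframe

/-! ### Spatial coordinates and the flat Laplacian -/

/-- The coordinate `y ↦ yᵃ`. -/
def coord (a : Fin 4) : E4 →L[ℝ] ℝ := EuclideanSpace.proj a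

/-- The projection to the spatial coordinates. -/
def spatial : E4 →L[ℝ] E3 :=
  (EuclideanSpace.equiv (Fin 3) ℝ).symm.toContinuousLinearMap.comp
    (ContinuousLinearMap.pi fun i : Fin 3 => coord i.succ)

theorem spatial_apply (y : E4) : spatial y = !₂[y 1, y 2, y 3] := by
  ext i
  fin_cases i <;> rfl

/-- The inclusion of the spatial directions. -/
def spatialIncl : E3 →L[ℝ] E4 :=
  (EuclideanSpace.equiv (Fin 4) ℝ).symm.toContinuousLinearMap.comp
    (ContinuousLinearMap.pi fun a : Fin 4 => Fin.cases 0
      (fun i => (EuclideanSpace.proj i : E3 →L[ℝ] ℝ)) a)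

theorem spatial_spatialIncl (w : E3) : spatial (spatialIncl w) = w := by
  ext i
  rfl

theorem spatialDomain_eq {M : Type*} [TopologicalSpace M] (φ : OpenPartialHomeomorph M E4) :
    spatialDomain φ = spatial '' φ.target := by
  unfold spatialDomain
  congr 1
  funext y
  exact (spatial_apply y).symm

theorem isOpen_spatialDomain {M : Type*} [TopologicalSpace M] (φ : OpenPartialHomeomorph M E4) :
    IsOpen (spatialDomain φ) := by
  rw [spatialDomain_eq]
  exact spatial.isOpenMap (fun w => ⟨spatialIncl w, spatial_spatialIncl w⟩) _ φ.open_target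

/-- The coordinate vector field `∂_b`. -/
def coordVec (b : Fin 4) : E4 := EuclideanSpace.single b (1 : ℝ)

theorem coordVec_apply (a b : Fin 4) : coordVec b a = if a = b then (1 : ℝ) else 0 := by
  simp [coordVec]

theorem spatial_coordVec_zero : spatial (coordVec 0) = 0 := by
  rw [spatial_apply]
  ext i
  fin_cases i <;> simp [coordVec]

theorem spatial_coordVec_succ (i : Fin 3) :
    spatial (coordVec i.succ) = EuclideanSpace.basisFun (Fin 3) ℝ i := by
  rw [spatial_apply]
  ext j
  fin_cases i <;> fin_cases j <;> simp [coordVec]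

open Laplacian in
theorem laplacian_eq_sum_coordVec (f : E3 → ℝ) (w : E3) :
    Δ f w = fderiv ℝ (fderiv ℝ f) w (spatial (coordVec 1)) (spatial (coordVec 1)) +
      fderiv ℝ (fderiv ℝ f) w (spatial (coordVec 2)) (spatial (coordVec 2)) +
      fderiv ℝ (fderiv ℝ f) w (spatial (coordVec 3)) (spatial (coordVec 3)) := by
  rw [InnerProductSpace.laplacian_eq_iteratedFDeriv_orthonormalBasis f
    (EuclideanSpace.basisFun (Fin 3) ℝ)]
  simp only [iteratedFDeriv_two_apply, Fin.sum_univ_three, ← spatial_coordVec_succ]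
  rfl

/-! ### Quasi-conformal coframes and harmonic functions -/

namespace Coframe

variable {M : Type*} [TopologicalSpace M] [ChartedSpace E4 M] {ϑ : Coframe M}
  {φ : OpenPartialHomeomorph M E4} {f : E3 → ℝ}

theorem IsQuasiConformal.cov_eq (hQ : ϑ.IsQuasiConformal φ f)
    (hφ : φ ∈ IsManifold.maximalAtlas (𝓡 4) ∞ M) {y : E4} (hy : y ∈ φ.target) (a : Fin 4) :
    ϑ.cov φ a y = Real.exp (-sgn a * f (spatial y)) •
      coord a := by
  have hx := φ.map_target hy
  have h1 : ϑ.form a (φ.symm y) = Real.exp (-sgn a * f (spatial y)) •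
      mvfderiv (𝓡 4) (fun z => φ z a) (φ.symm y) := by
    obtain ⟨h0, hi⟩ := hQ (φ.symm y) hx
    rw [φ.right_inv hy, ← spatial_apply] at h0 hi
    refine Fin.cases ?_ (fun i => ?_) a
    · rw [h0]; simp [sgn]
    · rw [hi i]; simp [sgn]
  have hd := mdifferentiable_of_mem_maximalAtlas hφ
  have h2 : mfderiv (𝓡 4) 𝓘(ℝ, ℝ) (fun z => φ z a) (φ.symm y) =
      ContinuousLinearMap.comp (coord a)
        (mfderiv (𝓡 4) 𝓘(ℝ, E4) φ (φ.symm y) : E4 →L[ℝ] E4) :=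
    ((coord a).hasMFDerivAt.comp (φ.symm y)
      (hd.mdifferentiableAt hx).hasMFDerivAt).mfderiv
  have h3 := hd.comp_symm_deriv hy
  obtain ⟨D, hD, hform⟩ : ∃ D : E4 →L[ℝ] ℝ,
      D = (coord a).comp (mfderiv (𝓡 4) 𝓘(ℝ, E4) φ (φ.symm y) : E4 →L[ℝ] E4) ∧
      (ϑ.form a (φ.symm y) : E4 →L[ℝ] ℝ) = Real.exp (-sgn a * f (spatial y)) • D := ⟨_, h2, h1⟩
  unfold cov
  rw [hform, hD]
  ext v
  refine congrArg (fun r : ℝ => Real.exp (-sgn a * f (spatial y)) * r) ?_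
  exact congrArg (fun T : E4 →L[ℝ] E4 => coord a (T v)) h3

theorem IsQuasiConformal.vec_eq (hQ : ϑ.IsQuasiConformal φ f)
    (hφ : φ ∈ IsManifold.maximalAtlas (𝓡 4) ∞ M) {y : E4} (hy : y ∈ φ.target) (b : Fin 4) :
    ϑ.vec φ b y = Real.exp (sgn b * f (spatial y)) • coordVec b := by
  apply (ϑ.bijective_cov hφ hy).1
  funext a
  refine (ϑ.cov_vec hφ hy a b).trans ?_
  change _ = ϑ.cov φ a y _
  rw [hQ.cov_eq hφ hy]
  change _ = Real.exp (-sgn a * f (spatial y)) *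
    (Real.exp (sgn b * f (spatial y)) * coordVec b a)
  rw [coordVec_apply]
  by_cases hab : a = b
  · subst hab
    simp [← Real.exp_add]
  · simp [hab]

variable [IsManifold (𝓡 4) ∞ M]

/-- No smoothness of f is assumed; it is inherited from the coframe, because ϑ¹(∂₁) = e^f is smooth
and has a smooth logarithm. -/
theorem IsQuasiConformal.contDiffAt (hQ : ϑ.IsQuasiConformal φ f)
    (hφ : φ ∈ IsManifold.maximalAtlas (𝓡 4) ∞ M) {y : E4} (hy : y ∈ φ.target) :
    ContDiffAt ℝ ∞ f (spatial y) := by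
  have h1 : ContDiffAt ℝ ∞ (fun z => f (spatial z)) y := by
    have h2 : ContDiffAt ℝ ∞ (fun z => ϑ.cov φ 1 z (coordVec 1)) y :=
      (ϑ.contDiffAt_cov hφ hy 1).clm_apply contDiffAt_const
    have h3 : (fun z => ϑ.cov φ 1 z (coordVec 1)) =ᶠ[𝓝 y] fun z => Real.exp (f (spatial z)) := by
      filter_upwards [φ.open_target.mem_nhds hy] with z hz
      rw [hQ.cov_eq hφ hz]
      change Real.exp (-sgn 1 * f (spatial z)) * coordVec 1 1 = _
      rw [coordVec_apply]
      simp [sgn]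
    have h4 := (h2.congr_of_eventuallyEq h3.symm).log (Real.exp_ne_zero _)
    simpa using h4
  -- An affine spatial slice through y is a section of the projection; it turns smoothness on
  -- spacetime into smoothness in the spatial variables.
  have h5 : ContDiffAt ℝ ∞ (fun w => y + spatialIncl (w - spatial y)) (spatial y) :=
    contDiffAt_const.add (spatialIncl.contDiff.contDiffAt.comp _ (contDiffAt_id.sub contDiffAt_const))
  have h6 : y + spatialIncl (spatial y - spatial y) = y := by simp
  have h7 : ContDiffAt ℝ ∞ (fun z => f (spatial z)) (y + spatialIncl (spatial y - spatial y)) := by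
    rwa [h6]
  refine (ContDiffAt.comp (g := fun z => f (spatial z)) (spatial y) h7 h5).congr_of_eventuallyEq
    (Eventually.of_forall fun w => ?_)
  simp [spatial_spatialIncl]

/-- `e^{-f} ∂_b f`. -/
def gradTerm (f : E3 → ℝ) (b : Fin 4) (y : E4) : ℝ :=
  Real.exp (-f (spatial y)) * fderiv ℝ f (spatial y) (spatial (coordVec b))

/-- `e^{-2f} ∂_b ∂_p f`. -/
def hessTerm (f : E3 → ℝ) (b p : Fin 4) (y : E4) : ℝ :=
  Real.exp (-f (spatial y)) * (Real.exp (-f (spatial y)) *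
    fderiv ℝ (fderiv ℝ f) (spatial y) (spatial (coordVec p)) (spatial (coordVec b)))

/-- Only ∂_t carries the other exponent, and its spatial part is zero. All frame derivatives of f
thus have the common factor e^{-f}. -/
theorem exp_sgn_smul_spatial_coordVec (r : ℝ) (b : Fin 4) :
    Real.exp (sgn b * r) • spatial (coordVec b) = Real.exp (-r) • spatial (coordVec b) := by
  by_cases hb : b = 0
  · rw [hb, spatial_coordVec_zero, smul_zero, smul_zero]
  · simp [sgn, hb]

theorem IsQuasiConformal.C_symm_eq (hQ : ϑ.IsQuasiConformal φ f)
    (hφ : φ ∈ IsManifold.maximalAtlas (𝓡 4) ∞ M) {y : E4} (hy : y ∈ φ.target) (a b c : Fin 4) :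
    ϑ.C a b c (φ.symm y) = -sgn a * ((if a = c then 1 else 0) * gradTerm f b y -
      (if a = b then 1 else 0) * gradTerm f c y) := by
  have hf : DifferentiableAt ℝ f (spatial y) := (hQ.contDiffAt hφ hy).differentiableAt (by simp)
  have h1 : ϑ.cov φ a =ᶠ[𝓝 y] fun z => Real.exp (-sgn a * f (spatial z)) •
      coord a := by
    filter_upwards [φ.open_target.mem_nhds hy] with z hz
    exact hQ.cov_eq hφ hz a
  have h2 : HasFDerivAt (fun z => f (spatial z)) ((fderiv ℝ f (spatial y)).comp spatial) y :=
    hf.hasFDerivAt.comp y spatial.hasFDerivAt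
  have h3 := ((h2.const_mul (-sgn a)).exp).smul_const
    (coord a)
  have h4 : ∀ b c, fderiv ℝ (ϑ.cov φ a) y (ϑ.vec φ b y) (ϑ.vec φ c y) =
      -sgn a * ((if a = c then 1 else 0) * gradTerm f b y) := by
    intro b c
    rw [h1.fderiv_eq, h3.fderiv, hQ.vec_eq hφ hy b, hQ.vec_eq hφ hy c]
    change (Real.exp (-sgn a * f (spatial y)) * (-sgn a * fderiv ℝ f (spatial y)
      (spatial (Real.exp (sgn b * f (spatial y)) • coordVec b)))) *
      (Real.exp (sgn c * f (spatial y)) * coordVec c a) = _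
    rw [map_smul, exp_sgn_smul_spatial_coordVec, map_smul, coordVec_apply, smul_eq_mul, gradTerm]
    by_cases hac : a = c
    · subst hac
      have h5 : Real.exp (-sgn a * f (spatial y)) * Real.exp (sgn a * f (spatial y)) = 1 := by
        simp [← Real.exp_add]
      simp only [if_true]
      linear_combination (-sgn a * (Real.exp (-f (spatial y)) *
        fderiv ℝ f (spatial y) (spatial (coordVec b)))) * h5
    · simp [hac]
  rw [ϑ.C_symm_eq_fderiv hφ hy, h4, h4]
  ring

theorem IsQuasiConformal.fderiv_gradTerm (hQ : ϑ.IsQuasiConformal φ f)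
    (hφ : φ ∈ IsManifold.maximalAtlas (𝓡 4) ∞ M) {y : E4} (hy : y ∈ φ.target) (b p : Fin 4) :
    DifferentiableAt ℝ (gradTerm f b) y ∧ fderiv ℝ (gradTerm f b) y (ϑ.vec φ p y) =
      hessTerm f b p y - gradTerm f b y * gradTerm f p y := by
  have hc := hQ.contDiffAt hφ hy
  have hf : DifferentiableAt ℝ f (spatial y) := hc.differentiableAt (by simp)
  have hf' : DifferentiableAt ℝ (fderiv ℝ f) (spatial y) :=
    (hc.fderiv_right (m := ∞) (by simp)).differentiableAt (by simp)
  have h1 : HasFDerivAt (fun z => f (spatial z)) ((fderiv ℝ f (spatial y)).comp spatial) y :=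
    hf.hasFDerivAt.comp y spatial.hasFDerivAt
  have h2 : HasFDerivAt (fun z => fderiv ℝ f (spatial z))
      ((fderiv ℝ (fderiv ℝ f) (spatial y)).comp spatial) y :=
    hf'.hasFDerivAt.comp y spatial.hasFDerivAt
  have h3 := h1.neg.exp.mul (h2.clm_apply (hasFDerivAt_const (spatial (coordVec b)) y))
  refine ⟨h3.differentiableAt, ?_⟩
  have h4 : fderiv ℝ (gradTerm f b) y = _ := h3.fderiv
  have h5 : spatial (ϑ.vec φ p y) = Real.exp (-f (spatial y)) • spatial (coordVec p) := by
    rw [hQ.vec_eq hφ hy, map_smul, exp_sgn_smul_spatial_coordVec]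
  rw [h4]
  simp [h5, gradTerm, hessTerm]
  ring

theorem IsQuasiConformal.B_eq (hQ : ϑ.IsQuasiConformal φ f)
    (hφ : φ ∈ IsManifold.maximalAtlas (𝓡 4) ∞ M) {x : M} (hx : x ∈ φ.source) (a b c p : Fin 4) :
    ϑ.B a b c p x = -sgn a * ((if a = c then 1 else 0) *
      (hessTerm f b p (φ x) - gradTerm f b (φ x) * gradTerm f p (φ x)) -
      (if a = b then 1 else 0) *
      (hessTerm f c p (φ x) - gradTerm f c (φ x) * gradTerm f p (φ x))) := by
  have hy := φ.map_source hx
  have h1 : (fun z => ϑ.C a b c (φ.symm z)) =ᶠ[𝓝 (φ x)] fun z =>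
      -sgn a * ((if a = c then 1 else 0) * gradTerm f b z -
        (if a = b then 1 else 0) * gradTerm f c z) := by
    filter_upwards [φ.open_target.mem_nhds hy] with z hz
    exact hQ.C_symm_eq hφ hz a b c
  have hb := hQ.fderiv_gradTerm hφ hy b p
  have hc := hQ.fderiv_gradTerm hφ hy c p
  have h2 : HasFDerivAt (fun z => -sgn a * ((if a = c then 1 else 0) * gradTerm f b z -
      (if a = b then 1 else 0) * gradTerm f c z))
      (-sgn a • ((if a = c then (1 : ℝ) else 0) • fderiv ℝ (gradTerm f b) (φ x) -
        (if a = b then (1 : ℝ) else 0) • fderiv ℝ (gradTerm f c) (φ x))) (φ x) :=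
    ((hb.1.hasFDerivAt.const_mul _).sub (hc.1.hasFDerivAt.const_mul _)).const_mul _
  rw [← ϑ.fderiv_C_symm hφ hx, h1.fderiv_eq, h2.fderiv, ← hb.2, ← hc.2]
  rfl

open Laplacian in
/-- The field equation for a quasi-conformal coframe. -/
theorem IsQuasiConformal.fieldEq_lhs (hQ : ϑ.IsQuasiConformal φ f)
    (hφ : φ ∈ IsManifold.maximalAtlas (𝓡 4) ∞ M) {p : Params} (hp : p.HarmonicConditions)
    {x : M} (hx : x ∈ φ.source) (a b : Fin 4) :
    ϑ.leading p x a b + ϑ.quadratic p x a b =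
      (if a = b then (if a = 0 then p.β₄ - p.β₁ else -(p.β₁ + p.β₄)) else 0) *
        (Real.exp (-f (spatial (φ x))) * (Real.exp (-f (spatial (φ x))) *
          Δ f (spatial (φ x)))) := by
  have hy := φ.map_source hx
  have hC := fun a b c => hQ.C_symm_eq hφ hy a b c
  rw [φ.left_inv hx] at hC
  -- Symmetry of second derivatives supplies the symmetry of K.
  have hsymm : IsSymmSndFDerivAt ℝ f (spatial (φ x)) :=
    ((hQ.contDiffAt hφ hy).isSymmSndFDerivAt
      (by rw [minSmoothness_of_isRCLikeNormedField]; exact WithTop.coe_le_coe.2 le_top))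
  rw [ϑ.fieldEq_lhs_of_C_eq hp (P := fun b => gradTerm f b (φ x))
    (K := fun b c => hessTerm f b c (φ x)) ?_ ?_ ?_ hC (hQ.B_eq hφ hx) a b]
  · rw [laplacian_eq_sum_coordVec]
    unfold hessTerm
    ring
  · simp [gradTerm, spatial_coordVec_zero]
  · intro b
    simp [hessTerm, spatial_coordVec_zero]
  · intro b c
    simp only [hessTerm]
    rw [hsymm.eq]

-- `HarmonicOnNhd` asks for C² and for Δf = 0 near each point. The first is automatic from the
-- coframe, the second follows from pointwise vanishing because the spatial domain is open.
open Laplacian in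
theorem IsQuasiConformal.harmonicOnNhd_iff (hQ : ϑ.IsQuasiConformal φ f)
    (hφ : φ ∈ IsManifold.maximalAtlas (𝓡 4) ∞ M) :
    InnerProductSpace.HarmonicOnNhd f (spatialDomain φ) ↔
      ∀ x ∈ φ.source, Δ f (spatial (φ x)) = 0 := by
  constructor
  · intro h x hx
    have hm : spatial (φ x) ∈ spatialDomain φ := by
      rw [spatialDomain_eq]
      exact mem_image_of_mem _ (φ.map_source hx)
    exact (h _ hm).2.self_of_nhds
  · intro h
    have h1 : ∀ w ∈ spatialDomain φ, Δ f w = 0 := by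
      intro w hw
      rw [spatialDomain_eq] at hw
      obtain ⟨y, hy, rfl⟩ := hw
      have h2 := h (φ.symm y) (φ.map_target hy)
      rwa [φ.right_inv hy] at h2
    intro w hw
    refine ⟨?_, ?_⟩
    · have hw' := hw
      rw [spatialDomain_eq] at hw'
      obtain ⟨y, hy, rfl⟩ := hw'
      exact (hQ.contDiffAt hφ hy).of_le (WithTop.coe_le_coe.2 le_top)
    · filter_upwards [(isOpen_spatialDomain φ).mem_nhds hw] with z hz
      exact h1 z hz

theorem IsQuasiConformal.fieldEq_of_harmonic (hQ : ϑ.IsQuasiConformal φ f)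
    (hφ : φ ∈ IsManifold.maximalAtlas (𝓡 4) ∞ M) {p : Params} (hp : p.HarmonicConditions)
    (h : InnerProductSpace.HarmonicOnNhd f (spatialDomain φ)) :
    ∀ x ∈ φ.source, ϑ.FieldEq p x := by
  intro x hx a b
  rw [hQ.fieldEq_lhs hφ hp hx, (hQ.harmonicOnNhd_iff hφ).1 h x hx]
  ring

theorem IsQuasiConformal.harmonic_of_fieldEq (hQ : ϑ.IsQuasiConformal φ f)
    (hφ : φ ∈ IsManifold.maximalAtlas (𝓡 4) ∞ M) {p : Params} (hp : p.HarmonicConditions)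
    (hne : p.β₁ ≠ 0 ∨ p.β₄ ≠ 0) (h : ∀ x ∈ φ.source, ϑ.FieldEq p x) :
    InnerProductSpace.HarmonicOnNhd f (spatialDomain φ) := by
  rw [hQ.harmonicOnNhd_iff hφ]
  intro x hx
  -- These components read (β₄ - β₁)Δf = 0 and (β₁ + β₄)Δf = 0 up to positive factors and sign. If
  -- Δf ≠ 0, then β₁ = β₄ = 0.
  have h0 := h x hx 0 0
  have h1 := h x hx 1 1
  rw [hQ.fieldEq_lhs hφ hp hx] at h0 h1
  simp only [if_true, one_ne_zero, if_false, mul_eq_zero, Real.exp_ne_zero, false_or] at h0 h1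
  rcases h0 with h0 | h0
  · rcases h1 with h1 | h1
    · rcases hne with hne | hne
      · exact absurd (by linarith) hne
      · exact absurd (by linarith) hne
    · exact h1
  · exact h0

end Coframe

end Teleparallel
end

theorem mainTheorem3 {M : Type*} [TopologicalSpace M] [ChartedSpace E4 M]
    [IsManifold (𝓡 4) ∞ M] (ϑ : Coframe M) :
    -- the formula for `□ϑᵃ`
    (∀ (a : Fin 4) (x : M), ϑ.boxForm a x =
      -(∑ b, (sgn a * ϑ.B1 x a b + sgn a * ϑ.B2 x a b +
          ∑ n, ϑ.C a b n x * (sgn n * ϑ.Ctr n x) +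
          1 / 2 * ∑ m, ∑ n, ϑ.C a m n x * (sgn m * sgn n * ϑ.Clow b m n x)) •
        oneForm (ϑ.form b) x)) ∧
    -- the wave-type equation is the member of the quasi-linear class with these parameters
    (∀ (x : M) (a b : Fin 4), ϑ.leading waveParams x a b + ϑ.quadratic waveParams x a b =
      -(sgn a * ϑ.boxMatrix x a b - 1 / 4 * (eta a b * ∑ m, ϑ.boxMatrix x m m))) ∧
    (∀ U : Set M, ϑ.WaveEqOn U ↔ ∀ x ∈ U, ϑ.FieldEq waveParams x) ∧
    -- the parameters satisfy the harmonic conditions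
    waveParams.HarmonicConditions ∧
    -- the meaning of the harmonic conditions
    (∀ (φ : OpenPartialHomeomorph M E4) (f : E3 → ℝ), φ ∈ IsManifold.maximalAtlas (𝓡 4) ∞ M →
      ϑ.IsQuasiConformal φ f →
      (∀ p : Params, p.HarmonicConditions →
        (InnerProductSpace.HarmonicOnNhd f (spatialDomain φ) → ∀ x ∈ φ.source, ϑ.FieldEq p x) ∧
        (p.β₁ ≠ 0 ∨ p.β₄ ≠ 0 → (∀ x ∈ φ.source, ϑ.FieldEq p x) →
          InnerProductSpace.HarmonicOnNhd f (spatialDomain φ))) ∧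
      (ϑ.WaveEqOn φ.source ↔ InnerProductSpace.HarmonicOnNhd f (spatialDomain φ))) := by
  refine ⟨ϑ.boxForm_eq, ϑ.leading_add_quadratic_waveParams, ϑ.waveEqOn_iff,
    harmonicConditions_waveParams, fun φ f hφ hQ => ⟨fun p hp =>
      ⟨hQ.fieldEq_of_harmonic hφ hp, hQ.harmonic_of_fieldEq hφ hp⟩, ?_⟩⟩
  rw [ϑ.waveEqOn_iff]
  exact ⟨hQ.harmonic_of_fieldEq hφ harmonicConditions_waveParams
      (Or.inl (by simp [waveParams])),
    hQ.fieldEq_of_harmonic hφ harmonicConditions_waveParams⟩
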